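/- Let $n\ge 1$ and $0\le p\le n$. Let $A^2(\mathbb C^n,e^{-|z|^2})$ be the Fock space of all entire functions $f$ on $\mathbb C^n$ with $\int_{\mathbb C^n}|f|^2e^{-|z|^2}\,d\lambda<\infty$ ($\lambda$ Lebesgue measure), with inner product $(f,g)=\int_{\mathbb C^n} f\,\overline g\,e^{-|z|^2}\,d\lambda$. Let $A^2_{(p,0)}$ be the Hilbert space of $(p,0)$-forms $f=\sum'_{|J|=p}f_J\,dz_J$ (sum over increasing multi-indices $J$) with coefficients $f_J\in A^2(\mathbb C^n,e^{-|z|^2})$ and norm $\|f\|^2=\sum'_{|J|=p}\|f_J\|^2$. Let $\partial$ be the densely defined operator $$\partial f=\sum_{|J|=p}{}^{'}\sum_{j=1}^n\frac{\partial f_J}{\partial z_j}\,dz_j\wedge dz_J,\qquad \operatorname{dom}(\partial)=\{f\in A^2_{(p,0)}:\partial f\in A^2_{(p+1,0)}\},$$ let $\partial^*$ be its Hilbert space adjoint, and let $\tilde\Box_p=\partial^*\partial+\partial\partial^*$ on $A^2_{(p,0)}$, with domain all $f\in\operatorname{dom}(\partial)\cap\operatorname{dom}(\partial^*)$ such that $\partial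 f\in\operatorname{dom}(\partial^*)$ and $\partial^*f\in\operatorname{dom}(\partial)$ (for $p=0$, $\tilde\Box_0=\partial^*\partial$). Then the spectrum of $\tilde\Box_p$ is exactly $\{m+p: m=0,1,2,\dots\}$, and for every $m\ge 0$ the number $m+p$ is an eigenvalue of $\tilde\Box_p$ of multiplicity $\binom{n+m-1}{n-1}\binom{n}{p}$ (the dimension of its eigenspace). Consequently, for $1\le p\le n$, the operator $\tilde\Box_p$ has an everywhere defined bounded inverse $\tilde N_p$ on $A^2_{(p,0)}$; this inverse is compact, and its eigenvalues are exactly the numbers $1/(m+p)$, $m=0,1,2,\dots$, with the same multiplicities $\binom{n+m-1}{n-1}\binom{n}{p}$. -/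

import Mathlib

open MeasureTheory
open scoped ComplexConjugate

noncomputable section

namespace FockComplex

/-! ### The Fock space -/

/-- The measure `e^{-|z|²} dλ(z)` on `ℂⁿ`, where `λ` is Lebesgue measure. -/
def fockMeasure (n : ℕ) : Measure (Fin n → ℂ) :=
  volume.withDensity fun z => ENNReal.ofReal (Real.exp (-∑ j, ‖z j‖ ^ 2))

/-- The entire functions on `ℂⁿ` that are square integrable for `e^{-|z|²} dλ(z)`. -/
def fockSubmodule (n : ℕ) : Submodule ℂ ((Fin n → ℂ) → ℂ) where
  carrier := {f | Differentiable ℂ f ∧ MemLp f 2 (fockMeasure n)}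
  zero_mem' := ⟨differentiable_const 0, MemLp.zero⟩
  add_mem' hf hg := ⟨hf.1.add hg.1, hf.2.add hg.2⟩
  smul_mem' c _ hf := ⟨hf.1.const_smul c, hf.2.const_smul c⟩

/-- The Fock space `A²(ℂⁿ, e^{-|z|²})`. It is a type of its own, so that it carries the topology of
its Hilbert space norm and not the topology of pointwise convergence. -/
def Fock (n : ℕ) : Type := fockSubmodule n

namespace Fock

variable {n : ℕ}

instance : AddCommGroup (Fock n) := inferInstanceAs (AddCommGroup (fockSubmodule n))

instance : Module ℂ (Fock n) := inferInstanceAs (Module ℂ (fockSubmodule n))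

instance : FunLike (Fock n) (Fin n → ℂ) ℂ where
  coe f := f.1
  coe_injective _ _ h := Subtype.ext h

theorem differentiable (f : Fock n) : Differentiable ℂ f := f.2.1

theorem memLp (f : Fock n) : MemLp f 2 (fockMeasure n) := f.2.2

@[ext]
theorem ext {f g : Fock n} (h : ∀ z, f z = g z) : f = g := DFunLike.ext _ _ h

@[simp] theorem zero_apply (z : Fin n → ℂ) : (0 : Fock n) z = 0 := rfl

@[simp] theorem add_apply (f g : Fock n) (z : Fin n → ℂ) : (f + g) z = f z + g z := rfl

@[simp] theorem smul_apply (c : ℂ) (f : Fock n) (z : Fin n → ℂ) : (c • f) z = c * f z := rfl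

theorem integrable_conj_mul (f g : Fock n) :
    Integrable (fun z => conj (f z) * g z) (fockMeasure n) :=
  f.memLp.star.integrable_mul g.memLp

theorem ae_volume_of_ae {P : (Fin n → ℂ) → Prop} (h : ∀ᵐ z ∂fockMeasure n, P z) :
    ∀ᵐ z, P z := by
  have hac : (volume : Measure (Fin n → ℂ)) ≪ fockMeasure n := by
    refine withDensity_absolutelyContinuous' ?_ ?_
    · exact Measurable.aemeasurable (by fun_prop)
    · filter_upwards with z
      simp [Real.exp_pos]
  exact hac.ae_le h

/-- The inner product `∫ f̄ g e^{-|z|²} dλ`, linear in the second argument. -/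
abbrev core (n : ℕ) : InnerProductSpace.Core ℂ (Fock n) where
  inner f g := ∫ z, conj (f z) * g z ∂fockMeasure n
  conj_inner_symm f g := by
    rw [← integral_conj]
    congr 1
    ext z
    simp [mul_comm]
  re_inner_nonneg f := by
    have : ∀ z, conj (f z) * f z = ((‖f z‖ ^ 2 : ℝ) : ℂ) := fun z => by
      rw [Complex.conj_mul']; norm_cast
    simp only [this]
    rw [integral_complex_ofReal]
    exact integral_nonneg fun z => by positivity
  add_left f g h := by
    rw [← integral_add (integrable_conj_mul f h) (integrable_conj_mul g h)]
    congr 1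
    ext z
    simp [add_mul]
  smul_left f g c := by
    rw [← integral_const_mul]
    congr 1
    ext z
    simp [mul_assoc]
  definite f hf := by
    have h1 : ∀ z, conj (f z) * f z = ((‖f z‖ ^ 2 : ℝ) : ℂ) := fun z => by
      rw [Complex.conj_mul']; norm_cast
    have hint : Integrable (fun z => ‖f z‖ ^ 2) (fockMeasure n) := 
      f.memLp.integrable_norm_pow two_ne_zero
    have hf' : ∫ z, conj (f z) * f z ∂fockMeasure n = 0 := hf
    simp only [h1] at hf'
    rw [integral_complex_ofReal, Complex.ofReal_eq_zero,
      integral_eq_zero_iff_of_nonneg (fun z => by positivity) hint] at hf'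
    have h2 : (f : (Fin n → ℂ) → ℂ) =ᵐ[volume] fun _ => 0 := by
      refine ae_volume_of_ae ?_
      filter_upwards [hf'] with z hz
      simpa using hz
    have h3 := (f.differentiable.continuous.ae_eq_iff_eq volume continuous_const).1 h2
    exact ext fun z => congrFun h3 z

instance : NormedAddCommGroup (Fock n) := (core n).toNormedAddCommGroup

instance : InnerProductSpace ℂ (Fock n) := InnerProductSpace.ofCore (core n).toCore

theorem inner_def (f g : Fock n) : inner ℂ f g = ∫ z, conj (f z) * g z ∂fockMeasure n := rfl

end Fock

/-! ### `(p,0)`-forms and the operator `∂` -/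

/-- Increasing multi-indices `J = (j₁ < ⋯ < j_p)` in `{1, …, n}`, as sets of `p` elements. -/
abbrev MultiIndex (n p : ℕ) : Type := {J : Finset (Fin n) // J.card = p}

/-- The space of `(p,0)`-forms `∑'_{|J|=p} f_J dz_J` with coefficients `f_J` in the Fock space; a form
is given by its coefficients, and its squared norm is `∑'_{|J|=p} ‖f_J‖²`. -/
abbrev Forms (n p : ℕ) : Type := PiLp 2 fun _ : MultiIndex n p => Fock n

/-- The coefficient of `dz_K` in `dz_j ∧ dz_J`: it is `0` if `j ∈ J`, and otherwise
`dz_j ∧ dz_J = (-1)^{#{i ∈ J : i < j}} dz_{J ∪ {j}}`. -/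
def wedgeCoeff {n : ℕ} (j : Fin n) (J K : Finset (Fin n)) : ℂ :=
  if j ∉ J ∧ insert j J = K then (-1) ^ (J.filter (· < j)).card else 0

/-- The partial derivative `∂f/∂z_j`. -/
def partialZ {n : ℕ} (j : Fin n) (f : (Fin n → ℂ) → ℂ) (z : Fin n → ℂ) : ℂ :=
  fderiv ℂ f z (Pi.single j 1)

/-- The coefficient functions of `∂f = ∑'_{|J|=p} ∑_j ∂f_J/∂z_j dz_j ∧ dz_J`. -/
def delCoeff {n p : ℕ} (f : Forms n p) (K : MultiIndex n (p + 1)) (z : Fin n → ℂ) : ℂ :=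
  ∑ J : MultiIndex n p, ∑ j : Fin n, partialZ j (f J) z * wedgeCoeff j J.1 K.1

theorem partialZ_add {n : ℕ} (j : Fin n) (f g : Fock n) (z : Fin n → ℂ) :
    partialZ j (f + g : Fock n) z = partialZ j f z + partialZ j g z := by
  have : ((f + g : Fock n) : (Fin n → ℂ) → ℂ) = (f : (Fin n → ℂ) → ℂ) + (g : (Fin n → ℂ) → ℂ) := rfl
  rw [partialZ, this, fderiv_add (f.differentiable z) (g.differentiable z)]
  rfl

theorem partialZ_smul {n : ℕ} (j : Fin n) (c : ℂ) (f : Fock n) (z : Fin n → ℂ) :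
    partialZ j (c • f : Fock n) z = c * partialZ j f z := by
  have : ((c • f : Fock n) : (Fin n → ℂ) → ℂ) = c • (f : (Fin n → ℂ) → ℂ) := rfl
  rw [partialZ, this, fderiv_const_smul (f.differentiable z)]
  rfl

theorem partialZ_zero {n : ℕ} (j : Fin n) (z : Fin n → ℂ) : partialZ j (0 : Fock n) z = 0 := by
  simpa using partialZ_smul j 0 (0 : Fock n) z

/-- The graph of `∂` on its maximal domain: the pairs `(f, ∂f)` with `f` and `∂f` both having
coefficients in the Fock space. -/
def delGraph (n p : ℕ) : Submodule ℂ (Forms n p × Forms n (p + 1)) where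
  carrier := {x | ∀ K z, x.2 K z = delCoeff x.1 K z}
  zero_mem' K z := by simp [delCoeff, partialZ_zero]
  add_mem' {x y} hx hy K z := by
    have h := hx K z
    have h' := hy K z
    simp only [delCoeff] at h h' ⊢
    simp [h, h', partialZ_add, add_mul, Finset.sum_add_distrib]
  smul_mem' c x hx K z := by
    have h := hx K z
    simp only [delCoeff] at h ⊢
    simp [h, partialZ_smul, mul_assoc, Finset.mul_sum]

/-- The unbounded operator `∂` from `(p,0)`-forms to `(p+1,0)`-forms, with domain
`{f : ∂f has coefficients in the Fock space}`. -/
def del (n p : ℕ) : Forms n p →ₗ.[ℂ] Forms n (p + 1) := (delGraph n p).toLinearPMap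

theorem del_graph (n p : ℕ) : (del n p).graph = delGraph n p := by
  refine Submodule.toLinearPMap_graph_eq _ fun x hx h0 => ?_
  ext K z
  rw [hx K z, h0]
  simp [delCoeff, partialZ_zero]

theorem mem_del_domain {n p : ℕ} (f : Forms n p) :
    f ∈ (del n p).domain ↔ ∃ g : Forms n (p + 1), ∀ K z, g K z = delCoeff f K z := by
  rw [LinearPMap.mem_domain_iff]
  simp only [del_graph]
  rfl

theorem del_apply {n p : ℕ} (f : (del n p).domain) (K : MultiIndex n (p + 1)) (z : Fin n → ℂ) :
    del n p f K z = delCoeff (f : Forms n p) K z := by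
  have h : ((f : Forms n p), del n p f) ∈ delGraph n p := by
    rw [← del_graph]
    exact LinearPMap.mem_graph _ f
  exact h K z

/-- The Hilbert space adjoint `∂*` of the densely defined operator `∂`: its graph consists of the
pairs `(g, h)` with `(∂f, g) = (f, h)` for all `f` in the domain of `∂`. -/
def delStar (n p : ℕ) : Forms n (p + 1) →ₗ.[ℂ] Forms n p := (del n p).graph.adjoint.toLinearPMap

/-! ### Unbounded operators -/

section Unbounded

variable {E F G : Type*} [NormedAddCommGroup E] [NormedSpace ℂ E] [NormedAddCommGroup F]
  [NormedSpace ℂ F] [NormedAddCommGroup G] [NormedSpace ℂ G]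

/-- The composition `S T` of unbounded operators, with domain `{x ∈ dom T : T x ∈ dom S}`. -/
def compOp (S : F →ₗ.[ℂ] G) (T : E →ₗ.[ℂ] F) : E →ₗ.[ℂ] G :=
  S.comp (T.domRestrict ((S.domain.comap T.toFun).map T.domain.subtype)) (by
    rintro ⟨x, ⟨⟨y, hy, hyx⟩, hx⟩⟩
    obtain rfl : (y : E) = x := hyx
    exact hy)

theorem mem_compOp_domain (S : F →ₗ.[ℂ] G) (T : E →ₗ.[ℂ] F) (x : E) :
    x ∈ (compOp S T).domain ↔ ∃ h : x ∈ T.domain, T ⟨x, h⟩ ∈ S.domain := by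
  constructor
  · rintro ⟨⟨y, hy, rfl⟩, hx⟩
    exact ⟨hx, hy⟩
  · rintro ⟨h, h'⟩
    exact ⟨⟨⟨x, h⟩, h', rfl⟩, h⟩

theorem compOp_apply (S : F →ₗ.[ℂ] G) (T : E →ₗ.[ℂ] F) (x : E) (h : x ∈ T.domain)
    (h' : T ⟨x, h⟩ ∈ S.domain) :
    compOp S T ⟨x, (mem_compOp_domain S T x).2 ⟨h, h'⟩⟩ = S ⟨T ⟨x, h⟩, h'⟩ := rfl

/-- The operator `T - c`, with the domain of `T`. -/
def subScalar (T : E →ₗ.[ℂ] E) (c : ℂ) : E →ₗ.[ℂ] E where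
  domain := T.domain
  toFun := T.toFun - c • T.domain.subtype

/-- `R` is an everywhere defined bounded inverse of the unbounded operator `T`. -/
structure IsBoundedInverse (T : E →ₗ.[ℂ] E) (R : E →L[ℂ] E) : Prop where
  mem_domain : ∀ u, R u ∈ T.domain
  right_inv : ∀ u, T ⟨R u, mem_domain u⟩ = u
  left_inv : ∀ x : T.domain, R (T x) = x

/-- The spectrum of `T`: all `c` for which `T - c` has no everywhere defined bounded inverse. -/
def spectrumOp (T : E →ₗ.[ℂ] E) : Set ℂ := {c | ¬ ∃ R : E →L[ℂ] E, IsBoundedInverse (subScalar T c) R}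

/-- The eigenspace `{x ∈ dom T : T x = c x}`. -/
def eigenspaceOp (T : E →ₗ.[ℂ] E) (c : ℂ) : Submodule ℂ E :=
  (LinearMap.ker (T.toFun - c • T.domain.subtype)).map T.domain.subtype

theorem mem_eigenspaceOp (T : E →ₗ.[ℂ] E) (c : ℂ) (x : E) :
    x ∈ eigenspaceOp T c ↔ ∃ h : x ∈ T.domain, T ⟨x, h⟩ = c • x := by
  constructor
  · rintro ⟨y, hy, rfl⟩
    exact ⟨y.2, sub_eq_zero.1 hy⟩
  · rintro ⟨h, h'⟩
    exact ⟨⟨x, h⟩, sub_eq_zero.2 h', rfl⟩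

end Unbounded

/-- The complex Laplacian `∂*∂ + ∂∂*` on `(p,0)`-forms, with domain all
`f ∈ dom ∂ ∩ dom ∂*` such that `∂f ∈ dom ∂*` and `∂*f ∈ dom ∂`; for `p = 0` it is `∂*∂`. -/
def box (n : ℕ) : (p : ℕ) → Forms n p →ₗ.[ℂ] Forms n p
  | 0 => compOp (delStar n 0) (del n 0)
  | p + 1 => compOp (delStar n (p + 1)) (del n (p + 1)) + compOp (del n p) (delStar n p)

end FockComplex

end

noncomputable section

namespace FockComplex

section

variable {n p : ℕ}

/-! ### Integration against the Gaussian weight -/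

/-! In the Fock space, multiplication by `z_j` is the adjoint of `∂/∂z_j`. On forms with polynomial
coefficients the formal adjoint of `∂` is therefore multiplication by `z_j` combined with
contraction. The relation `∂_j z_i = z_i ∂_j + δ_ij` and the anticommutation of exterior and
interior products reduce `∂*∂ + ∂∂*` to the Euler operator `∑ z_i ∂_i` plus `p`
(`polyLaplacian_zero`, `polyLaplacian_succ`). Forms with homogeneous coefficients of degree `m` are
thus eigenvectors for `m + p`, and counting monomials gives the multiplicity.

The analysis must show that the operator on its maximal domain has nothing beyond these
eigenvectors. The tool is the transform `h ↦ ∫ h(z) e^{w·z̄} e^{-|z|²} dλ(z)`. It reproduces entire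
functions up to a constant (`fockTransform_eq`), turns multiplication by `z̄_j` into `∂/∂w_j`
(`partialZ_fockTransform`), and vanishes exactly when all polynomial moments vanish
(`fockTransform_eq_zero_iff`). This yields completeness, density of polynomials, and the fact that
`∂` is the full adjoint of its formal adjoint on polynomial forms (`mem_delGraph_iff_inner`), with
no integration by parts or cutoff.

Testing against polynomial forms then determines every component of the Laplacian of a form in its
domain. Conversely, partial sums of homogeneous components converge in the graph norm, because
`‖∂q‖`, `‖∂*q‖` and both halves of the Laplacian are controlled by `‖q‖` and `‖□q‖`. So the
Laplacian is diagonal with maximal domain (`isDiagonal_box`). For such an operator with entries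
tending to infinity, the spectrum, the eigenspaces and the compact inverse are read off from the
entries. -/

theorem integral_fockMeasure (f : (Fin n → ℂ) → ℂ) :
    ∫ z, f z ∂fockMeasure n = ∫ z, Real.exp (-∑ j, ‖z j‖ ^ 2) • f z := by
  rw [fockMeasure, integral_withDensity_eq_integral_toReal_smul (by fun_prop) (by simp)]
  simp [ENNReal.toReal_ofReal (Real.exp_pos _).le]

theorem integrable_fockMeasure_iff {E : Type*} [NormedAddCommGroup E] [NormedSpace ℝ E]
    {f : (Fin n → ℂ) → E} :
    Integrable f (fockMeasure n) ↔ Integrable fun z => Real.exp (-∑ j, ‖z j‖ ^ 2) • f z := by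
  rw [fockMeasure, integrable_withDensity_iff_integrable_smul' (by fun_prop) (by simp)]
  simp [ENNReal.toReal_ofReal (Real.exp_pos _).le]

/-- Completing the square gives `R t - t² ≤ R²/2 - t²/2`, so a Gaussian of half the rate dominates.
-/
theorem integrable_exp_norm_sub_sq (R : ℝ) :
    Integrable fun z : ℂ => Real.exp (R * ‖z‖ - ‖z‖ ^ 2) := by
  have h := (GaussianFourier.integrable_cexp_neg_mul_sq_norm_add (V := ℂ) (b := 1 / 2)
    (by norm_num) 0 0).norm.const_mul (Real.exp (R ^ 2 / 2))
  refine h.mono' (by fun_prop) (Filter.Eventually.of_forall fun z => ?_)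
  rw [Real.norm_eq_abs, abs_of_pos (Real.exp_pos _), Complex.norm_exp, ← Real.exp_add]
  refine Real.exp_le_exp.2 ?_
  have : (-(1 / 2 : ℂ) * (‖z‖ : ℂ) ^ 2 + 0 * (inner ℝ (0 : ℂ) z : ℝ)).re = -(1 / 2) * ‖z‖ ^ 2 := by
    have : (-(1 / 2 : ℂ) * (‖z‖ : ℂ) ^ 2 + 0 * (inner ℝ (0 : ℂ) z : ℝ))
      = ((-(1 / 2) * ‖z‖ ^ 2 : ℝ) : ℂ) := by push_cast; ring
    rw [this, Complex.ofReal_re]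
  rw [this]
  nlinarith [sq_nonneg (‖z‖ - R)]

theorem integrable_exp_sum_norm (R : ℝ) :
    Integrable (fun z => Real.exp (R * ∑ j, ‖z j‖)) (fockMeasure n) := by
  rw [integrable_fockMeasure_iff]
  have h := Integrable.fintype_prod (ι := Fin n) (μ := fun _ => (volume : Measure ℂ))
    (f := fun _ => fun z : ℂ => Real.exp (R * ‖z‖ - ‖z‖ ^ 2))
    fun _ => integrable_exp_norm_sub_sq R
  refine h.congr (Filter.Eventually.of_forall fun z => ?_)
  simp only [smul_eq_mul]
  rw [← Real.exp_sum, ← Real.exp_add, Finset.sum_sub_distrib, Finset.mul_sum]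
  congr 1
  ring

instance : IsFiniteMeasure (fockMeasure n) := by
  have h := integrable_exp_sum_norm (n := n) 0
  simp only [zero_mul, Real.exp_zero] at h
  exact ((integrable_const_iff).1 h).resolve_left one_ne_zero

/-- The total mass of the measure `e^{-|z|²} dλ(z)`. -/
def fockMass (n : ℕ) : ℝ := (fockMeasure n).real Set.univ

/-- Only the nonvanishing of the mass is used later, so its value is never computed. -/
theorem fockMass_pos (n : ℕ) : 0 < fockMass n := by
  refine ENNReal.toReal_pos (fun h => ?_) (measure_ne_top _ _)
  have h0 : fockMeasure n = 0 := Measure.measure_univ_eq_zero.1 h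
  have h1 : ∀ᵐ _z : Fin n → ℂ, False := Fock.ae_volume_of_ae (by simp [h0])
  rw [Filter.eventually_false_iff_eq_bot, ae_eq_bot] at h1
  exact NeZero.ne _ h1

theorem norm_coord_le_exp (z : Fin n → ℂ) (j : Fin n) : ‖z j‖ ≤ Real.exp (∑ j, ‖z j‖) :=
  (Finset.single_le_sum (f := fun j => ‖z j‖) (fun _ _ => norm_nonneg _) (Finset.mem_univ j)).trans
    ((le_add_of_nonneg_right zero_le_one).trans (Real.add_one_le_exp _))

theorem norm_exp_sum_le (w z : Fin n → ℂ) :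
    ‖Complex.exp (∑ j, w j * conj (z j))‖ ≤ Real.exp (‖w‖ * ∑ j, ‖z j‖) := by
  rw [Complex.norm_exp]
  refine Real.exp_le_exp.2 ((Complex.re_le_norm _).trans ((norm_sum_le _ _).trans ?_))
  rw [Finset.mul_sum]
  gcongr with j
  rw [norm_mul, RCLike.norm_conj]
  gcongr
  exact norm_le_pi_norm w j

/-! ### Exponentially integrable functions and their transforms -/

/-- Integrability for `e^{-|z|²} dλ` against all exponentials. -/
def ExpIntegrable (h : (Fin n → ℂ) → ℂ) : Prop :=
  ∀ R : ℝ, Integrable (fun z => Real.exp (R * ∑ j, ‖z j‖) • h z) (fockMeasure n)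

/-- Cauchy–Schwarz, since all exponentials are square integrable for the Gaussian. Unlike `L²`, the
larger class is stable under multiplication by `z̄_j` and by `e^{w·z̄}`. -/
theorem _root_.MeasureTheory.MemLp.expIntegrable {h : (Fin n → ℂ) → ℂ}
    (hh : MemLp h 2 (fockMeasure n)) : ExpIntegrable h := by
  intro R
  have h1 : MemLp (fun z : Fin n → ℂ => Real.exp (R * ∑ j, ‖z j‖)) 2 (fockMeasure n) := by
    rw [memLp_two_iff_integrable_sq (Continuous.aestronglyMeasurable (by fun_prop))]
    refine (integrable_exp_sum_norm (2 * R)).congr (Filter.Eventually.of_forall fun z => ?_)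
    simp only [← Real.exp_nat_mul]
    congr 1
    push_cast
    ring
  have h2 := MemLp.integrable_mul (p := 2) (q := 2) h1.ofReal hh
  exact h2

namespace ExpIntegrable

variable {h g : (Fin n → ℂ) → ℂ}

theorem integrable (hh : ExpIntegrable h) : Integrable h (fockMeasure n) := by
  simpa using hh 0

theorem add (hh : ExpIntegrable h) (hg : ExpIntegrable g) :
    ExpIntegrable fun z => h z + g z := fun R => by
  simpa only [smul_add] using! (hh R).add (hg R)

theorem sub (hh : ExpIntegrable h) (hg : ExpIntegrable g) :
    ExpIntegrable fun z => h z - g z := fun R => by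
  simpa only [smul_sub] using! (hh R).sub (hg R)

theorem sum {ι : Type*} (s : Finset ι) {F : ι → (Fin n → ℂ) → ℂ}
    (hF : ∀ i, ExpIntegrable (F i)) : ExpIntegrable fun z => ∑ i ∈ s, F i z := fun R => by
  refine (integrable_finsetSum s fun i _ => hF i R).congr (Filter.Eventually.of_forall fun z => ?_)
  simp only [Finset.smul_sum]

theorem mul_of_bound (hh : ExpIntegrable h) {g : (Fin n → ℂ) → ℂ} (hg : Continuous g) {C R : ℝ}
    (hC : ∀ z, ‖g z‖ ≤ C * Real.exp (R * ∑ j, ‖z j‖)) : ExpIntegrable fun z => g z * h z := by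
  intro S
  have hm : AEStronglyMeasurable (fun z => Real.exp (S * ∑ j, ‖z j‖) • (g z * h z))
      (fockMeasure n) := by
    have h1 : AEStronglyMeasurable (fun z : Fin n → ℂ => Real.exp (S * ∑ j, ‖z j‖))
      (fockMeasure n) := Continuous.aestronglyMeasurable (by fun_prop)
    have h2 : AEStronglyMeasurable (fun z => g z * h z) (fockMeasure n) :=
      hg.aestronglyMeasurable.mul hh.integrable.1
    exact h1.smul h2
  refine Integrable.mono' (g := fun z => C * ‖Real.exp ((S + R) * ∑ j, ‖z j‖) • h z‖)
    ((hh (S + R)).norm.const_mul C) hm (Filter.Eventually.of_forall fun z => ?_)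
  · simp only [norm_smul, Real.norm_eq_abs, Real.abs_exp, norm_mul]
    rw [add_mul, Real.exp_add]
    calc _ ≤ Real.exp (S * ∑ j, ‖z j‖) * ((C * Real.exp (R * ∑ j, ‖z j‖)) * ‖h z‖) := by
            gcongr; exact hC z
      _ = _ := by ring

theorem const_mul (hh : ExpIntegrable h) (c : ℂ) : ExpIntegrable fun z => c * h z :=
  hh.mul_of_bound (g := fun _ => c) continuous_const (C := ‖c‖) (R := 0) (by simp)

theorem conj_coord_mul (hh : ExpIntegrable h) (j : Fin n) :
    ExpIntegrable fun z => conj (z j) * h z :=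
  hh.mul_of_bound (g := fun z => conj (z j)) (by fun_prop) (C := 1) (R := 1)
    (by simpa using fun z => norm_coord_le_exp z j)

theorem exp_mul (hh : ExpIntegrable h) (w : Fin n → ℂ) :
    ExpIntegrable fun z => Complex.exp (∑ j, w j * conj (z j)) * h z :=
  hh.mul_of_bound (by fun_prop) (C := 1) (R := ‖w‖) (by simpa using norm_exp_sum_le w)

end ExpIntegrable

/-- The transform `w ↦ ∫ h(z) e^{w·z̄} e^{-|z|²} dλ(z)`. -/
def fockTransform (h : (Fin n → ℂ) → ℂ) (w : Fin n → ℂ) : ℂ :=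
  ∫ z, Complex.exp (∑ j, w j * conj (z j)) * h z ∂fockMeasure n

theorem fockTransform_sub {h g : (Fin n → ℂ) → ℂ} (hh : ExpIntegrable h) (hg : ExpIntegrable g)
    (w : Fin n → ℂ) :
    fockTransform (fun z => h z - g z) w = fockTransform h w - fockTransform g w := by
  simp only [fockTransform, mul_sub]
  exact integral_sub (hh.exp_mul w).integrable (hg.exp_mul w).integrable

theorem fockTransform_sum {ι : Type*} (s : Finset ι) {F : ι → (Fin n → ℂ) → ℂ}
    (hF : ∀ i, ExpIntegrable (F i)) (w : Fin n → ℂ) :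
    fockTransform (fun z => ∑ i ∈ s, F i z) w = ∑ i ∈ s, fockTransform (F i) w := by
  simp only [fockTransform, Finset.mul_sum]
  exact integral_finsetSum s fun i _ => ((hF i).exp_mul w).integrable

theorem fockTransform_const_mul (c : ℂ) (h : (Fin n → ℂ) → ℂ) (w : Fin n → ℂ) :
    fockTransform (fun z => c * h z) w = c * fockTransform h w := by
  simp only [fockTransform, ← integral_const_mul]
  congr 1
  ext z
  ring

/-- The linear functional `v ↦ ∑ v_j z̄_j`. -/
def conjPairing (z : Fin n → ℂ) : (Fin n → ℂ) →L[ℂ] ℂ :=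
  ∑ j, conj (z j) • ContinuousLinearMap.proj (R := ℂ) (φ := fun _ : Fin n => ℂ) j

theorem conjPairing_apply (z v : Fin n → ℂ) : conjPairing z v = ∑ j, v j * conj (z j) := by
  simp [conjPairing, mul_comm]

theorem norm_conjPairing_le (z : Fin n → ℂ) : ‖conjPairing z‖ ≤ Real.exp (∑ j, ‖z j‖) := by
  refine le_trans ?_ ((le_add_of_nonneg_right zero_le_one).trans (Real.add_one_le_exp _))
  refine ContinuousLinearMap.opNorm_le_bound _ (Finset.sum_nonneg fun _ _ => norm_nonneg _)
    fun v => ?_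
  rw [conjPairing_apply, Finset.sum_mul]
  refine (norm_sum_le _ _).trans (Finset.sum_le_sum fun j _ => ?_)
  rw [norm_mul, RCLike.norm_conj, mul_comm]
  gcongr
  exact norm_le_pi_norm v j

theorem continuous_conjPairing : Continuous (conjPairing (n := n)) := by
  unfold conjPairing
  fun_prop

theorem ExpIntegrable.integrable_smul_conjPairing {h : (Fin n → ℂ) → ℂ} (hh : ExpIntegrable h)
    (w : Fin n → ℂ) : Integrable
      (fun z => (Complex.exp (∑ j, w j * conj (z j)) * h z) • conjPairing z) (fockMeasure n) := by
  refine ((hh.exp_mul w) 1).norm.mono' ((hh.exp_mul w).integrable.aestronglyMeasurable.smul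
    continuous_conjPairing.aestronglyMeasurable) (Filter.Eventually.of_forall fun z => ?_)
  rw [norm_smul, norm_smul, Real.norm_eq_abs, Real.abs_exp, one_mul, mul_comm]
  gcongr
  exact norm_conjPairing_le z

theorem hasFDerivAt_exp_mul (z : Fin n → ℂ) (c : ℂ) (v : Fin n → ℂ) :
    HasFDerivAt (fun v : Fin n → ℂ => Complex.exp (∑ j, v j * conj (z j)) * c)
      ((Complex.exp (∑ j, v j * conj (z j)) * c) • conjPairing z) v := by
  have h1 : HasFDerivAt (fun v : Fin n → ℂ => ∑ j, v j * conj (z j)) (conjPairing z) v := by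
    simpa only [← conjPairing_apply] using (conjPairing z).hasFDerivAt
  have h2 := (h1.cexp).mul_const c
  rwa [smul_smul, mul_comm c] at h2

/-- The majorant for differentiating under the integral. In the exponent, one `1` is the radius of
the ball and the other absorbs the factor `conjPairing z`. -/
theorem norm_smul_conjPairing_le (w v z : Fin n → ℂ) (hv : v ∈ Metric.ball w 1) (c : ℂ) :
    ‖(Complex.exp (∑ j, v j * conj (z j)) * c) • conjPairing z‖ ≤
      ‖Real.exp ((‖w‖ + 1 + 1) * ∑ j, ‖z j‖) • c‖ := by
  have hv' : ‖v‖ ≤ ‖w‖ + 1 := by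
    have h1 : ‖v - w‖ < 1 := by simpa [dist_eq_norm] using hv
    linarith [norm_sub_norm_le v w]
  rw [norm_smul, norm_smul, norm_mul, Real.norm_eq_abs, Real.abs_exp, add_mul _ 1, Real.exp_add,
    one_mul]
  calc _ ≤ Real.exp (‖v‖ * ∑ j, ‖z j‖) * ‖c‖ * Real.exp (∑ j, ‖z j‖) := by
          gcongr
          · exact norm_exp_sum_le v z
          · exact norm_conjPairing_le z
    _ ≤ Real.exp ((‖w‖ + 1) * ∑ j, ‖z j‖) * ‖c‖ * Real.exp (∑ j, ‖z j‖) := by gcongr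
    _ = _ := by ring

theorem hasFDerivAt_fockTransform {h : (Fin n → ℂ) → ℂ} (hh : ExpIntegrable h)
    (w : Fin n → ℂ) : HasFDerivAt (fockTransform h)
      (∫ z, (Complex.exp (∑ j, w j * conj (z j)) * h z) • conjPairing z ∂fockMeasure n) w := by
  have hb : Integrable (fun z => ‖Real.exp ((‖w‖ + 1 + 1) * ∑ j, ‖z j‖) • h z‖) (fockMeasure n) :=
    (hh (‖w‖ + 1 + 1)).norm
  have hm : ∀ v : Fin n → ℂ, AEStronglyMeasurable
      (fun z => Complex.exp (∑ j, v j * conj (z j)) * h z) (fockMeasure n) :=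
    fun v => (hh.exp_mul v).integrable.1
  have hd : ∀ᵐ z ∂fockMeasure n, ∀ v ∈ Metric.ball w 1, HasFDerivAt
      (fun v : Fin n → ℂ => Complex.exp (∑ j, v j * conj (z j)) * h z)
      ((Complex.exp (∑ j, v j * conj (z j)) * h z) • conjPairing z) v :=
    Filter.Eventually.of_forall fun z v _ => hasFDerivAt_exp_mul z (h z) v
  have hn : ∀ᵐ z ∂fockMeasure n, ∀ v ∈ Metric.ball w 1,
    ‖(Complex.exp (∑ j, v j * conj (z j)) * h z) • conjPairing z‖ ≤
      ‖Real.exp ((‖w‖ + 1 + 1) * ∑ j, ‖z j‖) • h z‖ :=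
    (Filter.Eventually.of_forall fun z v hv => norm_smul_conjPairing_le w v z hv (h z))
  have hi := (hh.exp_mul w).integrable
  have hs := (hh.integrable_smul_conjPairing w).1
  have hm' := Filter.Eventually.of_forall (f := nhds w) hm
  have key := hasFDerivAt_integral_of_dominated_of_fderiv_le (𝕜 := ℂ) (μ := fockMeasure n)
    (F := fun w z => Complex.exp (∑ j, w j * conj (z j)) * h z) (x₀ := w)
    (F' := fun w z => (Complex.exp (∑ j, w j * conj (z j)) * h z) • conjPairing z) (s := Metric.ball w 1)
    (bound := fun z => ‖Real.exp ((‖w‖ + 1 + 1) * ∑ j, ‖z j‖) • h z‖)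
  exact key (Metric.ball_mem_nhds w one_pos) hm' hi hs hn hb hd

theorem differentiable_fockTransform {h : (Fin n → ℂ) → ℂ} (hh : ExpIntegrable h) :
    Differentiable ℂ (fockTransform h) :=
  fun w => (hasFDerivAt_fockTransform hh w).differentiableAt

theorem partialZ_fockTransform {h : (Fin n → ℂ) → ℂ} (hh : ExpIntegrable h) (j : Fin n)
    (w : Fin n → ℂ) :
    partialZ j (fockTransform h) w = fockTransform (fun z => conj (z j) * h z) w := by
  rw [partialZ, (hasFDerivAt_fockTransform hh w).fderiv,
    ContinuousLinearMap.integral_apply (hh.integrable_smul_conjPairing w)]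
  refine integral_congr_ae (Filter.Eventually.of_forall fun z => ?_)
  simp only [smul_apply, conjPairing_apply, smul_eq_mul, Pi.single_apply, ite_mul, one_mul,
    zero_mul, Finset.sum_ite_eq', Finset.mem_univ, if_true]
  ring

/-! ### The reproducing formula -/

theorem measurePreserving_rotation (c : Circle) :
    MeasurePreserving (fun z : Fin n → ℂ => fun j => (c : ℂ) * z j) volume volume :=
  volume_preserving_pi fun _ => (rotation c).measurePreserving

theorem measurable_rotation (c : Circle) :
    Measurable (fun z : Fin n → ℂ => fun j => (c : ℂ) * z j) := by fun_prop

theorem measurePreserving_rotation_fockMeasure (c : Circle) :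
    MeasurePreserving (fun z : Fin n → ℂ => fun j => (c : ℂ) * z j) (fockMeasure n)
      (fockMeasure n) := by
  refine ⟨measurable_rotation c, Measure.ext fun s hs => ?_⟩
  rw [Measure.map_apply (measurable_rotation c) hs, fockMeasure,
    withDensity_apply _ (measurable_rotation c hs), withDensity_apply _ hs,
    ← (measurePreserving_rotation c).setLIntegral_comp_preimage hs (by fun_prop)]
  simp only [norm_mul, Circle.norm_coe, one_mul]

theorem integral_rotation (c : Circle) {g : (Fin n → ℂ) → ℂ} (hg : Continuous g) :
    ∫ z, g (fun j => (c : ℂ) * z j) ∂fockMeasure n = ∫ z, g z ∂fockMeasure n := by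
  have h := (measurePreserving_rotation_fockMeasure (n := n) c)
  conv_rhs => rw [← h.map_eq]
  rw [integral_map h.measurable.aemeasurable (by rw [h.map_eq]; exact hg.aestronglyMeasurable)]

/-- The mean value property for the rotation invariant measure `e^{-|z|²} dλ`. -/
theorem integral_eq_of_differentiable {g : (Fin n → ℂ) → ℂ} (hg : Differentiable ℂ g)
    (hi : Integrable g (fockMeasure n)) : ∫ z, g z ∂fockMeasure n = fockMass n * g 0 := by
  have hrot : ∀ θ : ℝ, ∫ z, g (fun j => Complex.exp (θ * Complex.I) * z j) ∂fockMeasure n =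
      ∫ z, g z ∂fockMeasure n := fun θ => by
    simpa using integral_rotation (Circle.exp θ) hg.continuous
  have hrotn : ∀ θ : ℝ, ∫ z, ‖g (fun j => Complex.exp (θ * Complex.I) * z j)‖ ∂fockMeasure n =
      ∫ z, ‖g z‖ ∂fockMeasure n := fun θ => by
    have := (measurePreserving_rotation_fockMeasure (n := n) (Circle.exp θ))
    conv_rhs => rw [← this.map_eq]
    rw [integral_map this.measurable.aemeasurable
      (by rw [this.map_eq]; exact hg.continuous.norm.aestronglyMeasurable)]
    simp
  -- The one-variable mean value property of the entire function `ζ ↦ g(ζ z)` on the unit circle.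
  have hmean : ∀ z : Fin n → ℂ,
      ∫ θ in (0 : ℝ)..2 * Real.pi, g (fun j => Complex.exp (θ * Complex.I) * z j) =
        2 * Real.pi * g 0 := fun z => by
    have hd : Differentiable ℂ fun ζ : ℂ => g (fun j => ζ * z j) :=
      hg.comp (by fun_prop)
    have h := hd.diffContOnCl (s := Metric.ball 0 |1|) |>.circleAverage
    simp only [Real.circleAverage_def, circleMap, zero_add, Complex.ofReal_one, one_mul, zero_mul] at h
    have h0 : (fun _ : Fin n => (0 : ℂ)) = 0 := rfl
    rw [h0] at h
    rw [← h, Complex.real_smul]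
    push_cast
    rw [mul_inv_cancel_left₀ (by simp)]
  have hint : Integrable (Function.uncurry fun (θ : ℝ) (z : Fin n → ℂ) =>
      g (fun j => Complex.exp (θ * Complex.I) * z j))
      ((volume.restrict (Set.uIoc 0 (2 * Real.pi))).prod (fockMeasure n)) := by
    have hc : Continuous (Function.uncurry fun (θ : ℝ) (z : Fin n → ℂ) =>
      g (fun j => Complex.exp (θ * Complex.I) * z j)) :=
      hg.continuous.comp (by fun_prop)
    rw [integrable_prod_iff hc.aestronglyMeasurable]
    refine ⟨Filter.Eventually.of_forall fun θ => ?_, ?_⟩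
    · have := (measurePreserving_rotation_fockMeasure (n := n) (Circle.exp θ)).integrable_comp
        (g := g) hg.continuous.aestronglyMeasurable
      simpa [Function.comp_def] using this.2 hi
    · simp only [Function.uncurry, hrotn]
      have : IsFiniteMeasure (volume.restrict (Set.uIoc 0 (2 * Real.pi))) :=
        ⟨by rw [Measure.restrict_apply_univ, Set.uIoc]; exact measure_Ioc_lt_top⟩
      exact integrable_const _
  -- Averaging over rotations and exchanging integrals: one order gives `2π ∫ g` by rotation
  -- invariance, the other `2π g(0)` times the mass.
  have hswap := intervalIntegral_integral_swap hint
  simp only [hrot, hmean] at hswap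
  rw [intervalIntegral.integral_const, integral_const, sub_zero] at hswap
  have hpi : (2 * Real.pi : ℂ) ≠ 0 := by exact_mod_cast Real.two_pi_pos.ne'
  apply mul_left_cancel₀ hpi
  rw [Complex.real_smul, Complex.real_smul] at hswap
  rw [fockMass]
  push_cast at hswap
  rw [hswap]
  ring

theorem sum_norm_sq_add (w z : Fin n → ℂ) :
    ((∑ j, ‖(z + w) j‖ ^ 2 : ℝ) : ℂ) = (∑ j, ‖z j‖ ^ 2 : ℝ) + ∑ j, w j * conj ((z + w) j)
      + ∑ j, z j * conj (w j) := by
  push_cast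
  rw [← Finset.sum_add_distrib, ← Finset.sum_add_distrib]
  refine Finset.sum_congr rfl fun j _ => ?_
  rw [← Complex.mul_conj', ← Complex.mul_conj']
  simp
  ring

/-- After the translation `z ↦ z + w`, the exponent `w·conj(z + w) - |z + w|²` equals `-|z|² -
z·w̄`. What multiplies the Gaussian is then the entire function `e^{-z·w̄} f(z + w)`, and the mean
value property evaluates its integral at `z = 0`. -/
theorem fockTransform_eq {f : (Fin n → ℂ) → ℂ} (hf : Differentiable ℂ f)
    (hh : ExpIntegrable f) (w : Fin n → ℂ) : fockTransform f w = fockMass n * f w := by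
  have hkey : ∀ z : Fin n → ℂ, Real.exp (-∑ j, ‖(z + w) j‖ ^ 2) •
        (Complex.exp (∑ j, w j * conj ((z + w) j)) * f (z + w)) =
      Real.exp (-∑ j, ‖z j‖ ^ 2) • (Complex.exp (-∑ j, z j * conj (w j)) * f (z + w)) := fun z => by
    rw [Complex.real_smul, Complex.real_smul, ← mul_assoc, ← mul_assoc, Complex.ofReal_exp,
      Complex.ofReal_exp, ← Complex.exp_add, ← Complex.exp_add, Complex.ofReal_neg, sum_norm_sq_add]
    congr 2
    push_cast
    ring
  have hd : Differentiable ℂ fun z => Complex.exp (-∑ j, z j * conj (w j)) * f (z + w) := by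
    have : Differentiable ℂ fun z => f (z + w) := hf.comp (by fun_prop)
    fun_prop
  have hi : Integrable (fun z => Complex.exp (-∑ j, z j * conj (w j)) * f (z + w))
      (fockMeasure n) := by
    rw [integrable_fockMeasure_iff]
    have := integrable_fockMeasure_iff.1 (hh.exp_mul w).integrable
    simpa only [hkey] using! this.comp_add_right w
  have h := integral_eq_of_differentiable hd hi
  simp only [zero_add, Pi.zero_apply, zero_mul, Finset.sum_const_zero, neg_zero, Complex.exp_zero,
    one_mul] at h
  rw [← h, fockTransform, integral_fockMeasure, integral_fockMeasure,
    ← integral_add_right_eq_self _ w]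
  exact integral_congr_ae (Filter.Eventually.of_forall hkey)

theorem Fock.expIntegrable (f : Fock n) : ExpIntegrable f := f.memLp.expIntegrable

theorem Fock.fockTransform_eq (f : Fock n) (w : Fin n → ℂ) :
    fockTransform f w = fockMass n * f w :=
  FockComplex.fockTransform_eq f.differentiable f.expIntegrable w

theorem Fock.fockTransform_eq' (f : Fock n) :
    fockTransform f = fun w => fockMass n * f w :=
  funext f.fockTransform_eq

/-- The reproducing formula differentiated in `w_j`. It replaces integration by parts and requires
no square integrability of the derivative. -/
theorem Fock.fockTransform_conj_coord_mul (f : Fock n) (j : Fin n) (w : Fin n → ℂ) :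
    fockTransform (fun z => conj (z j) * f z) w = fockMass n * partialZ j f w := by
  rw [← partialZ_fockTransform f.expIntegrable, f.fockTransform_eq', partialZ, partialZ,
    fderiv_const_mul (f.differentiable w)]
  simp

/-! ### Completeness of the Fock space -/

/-- The inclusion of the Fock space in `L²(e^{-|z|²} dλ)`. -/
def Fock.toL2 (n : ℕ) : Fock n →ₗᵢ[ℂ] Lp ℂ 2 (fockMeasure n) where
  toFun f := f.memLp.toLp f
  map_add' f g := f.memLp.toLp_add g.memLp
  map_smul' c f := f.memLp.toLp_const_smul c
  norm_map' f := by
    have h : inner ℂ (f.memLp.toLp f) (f.memLp.toLp f) = inner ℂ f f := by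
      rw [L2.inner_def, Fock.inner_def]
      refine integral_congr_ae ?_
      filter_upwards [f.memLp.coeFn_toLp] with z hz
      rw [hz, RCLike.inner_apply, mul_comm]
    rw [@norm_eq_sqrt_re_inner ℂ, @norm_eq_sqrt_re_inner ℂ _ _ _ _ f]
    exact congrArg (fun x => √(RCLike.re x)) h

theorem Fock.toL2_ae_eq (f : Fock n) : Fock.toL2 n f =ᵐ[fockMeasure n] f := f.memLp.coeFn_toLp

theorem memLp_exp (w : Fin n → ℂ) :
    MemLp (fun z => Complex.exp (∑ j, z j * conj (w j))) 2 (fockMeasure n) := by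
  rw [memLp_two_iff_integrable_sq_norm (Continuous.aestronglyMeasurable (by fun_prop))]
  refine (integrable_exp_sum_norm (2 * ‖w‖)).mono' (Continuous.aestronglyMeasurable (by fun_prop))
    (Filter.Eventually.of_forall fun z => ?_)
  have h := norm_exp_sum_le w z
  have h1 : Complex.exp (∑ j, z j * conj (w j)) = conj (Complex.exp (∑ j, w j * conj (z j))) := by
    rw [← Complex.exp_conj]
    simp [mul_comm]
  rw [h1, RCLike.norm_conj, Real.norm_eq_abs, abs_of_nonneg (sq_nonneg _), mul_assoc, two_mul,
    Real.exp_add, sq]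
  gcongr

theorem fockTransform_eq_inner (w : Fin n → ℂ) (f : Lp ℂ 2 (fockMeasure n)) :
    fockTransform f w = inner ℂ ((memLp_exp w).toLp _) f := by
  rw [L2.inner_def, fockTransform]
  refine integral_congr_ae ?_
  filter_upwards [(memLp_exp w).coeFn_toLp] with z hz
  rw [hz, RCLike.inner_apply, ← Complex.exp_conj, mul_comm]
  simp [mul_comm]

theorem fockTransform_congr_ae {f g : (Fin n → ℂ) → ℂ} (h : f =ᵐ[fockMeasure n] g)
    (w : Fin n → ℂ) : fockTransform f w = fockTransform g w := by
  refine integral_congr_ae ?_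
  filter_upwards [h] with z hz
  rw [hz]

/-- For fixed `w` the transform at `w` is an inner product, hence continuous on `L²`. The
reproducing formula therefore passes to the limit along an almost everywhere convergent subsequence,
and the limit has an entire representative, namely its own rescaled transform. -/
theorem Fock.isClosed_range_toL2 : IsClosed (Set.range (Fock.toL2 n)) := by
  refine isSeqClosed_iff_isClosed.1 fun x f hx hf => ?_
  choose F hF using hx
  have hae : (f : (Fin n → ℂ) → ℂ) =ᵐ[fockMeasure n]
      fun w => (fockMass n : ℂ)⁻¹ * fockTransform f w := by
    obtain ⟨ns, hns, hlim⟩ := (tendstoInMeasure_of_tendsto_Lp hf).exists_seq_tendsto_ae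
    have hall : ∀ᵐ z ∂fockMeasure n, ∀ k, x k z = F k z := by
      rw [ae_all_iff]
      intro k
      rw [← hF k]
      exact (F k).toL2_ae_eq
    filter_upwards [hlim, hall] with w hw hxw
    refine tendsto_nhds_unique hw ?_
    have h1 : Filter.Tendsto (fun k => inner ℂ ((memLp_exp w).toLp _) (x (ns k))) Filter.atTop
        (nhds (inner ℂ ((memLp_exp w).toLp _) f)) :=
      tendsto_const_nhds.inner (hf.comp hns.tendsto_atTop)
    rw [fockTransform_eq_inner]
    refine (h1.const_mul (fockMass n : ℂ)⁻¹).congr fun k => ?_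
    rw [← fockTransform_eq_inner, hxw, ← hF,
      fockTransform_congr_ae (F (ns k)).toL2_ae_eq, Fock.fockTransform_eq, ← mul_assoc,
      inv_mul_cancel₀ (by exact_mod_cast (fockMass_pos n).ne'), one_mul]
  have hd : Differentiable ℂ fun w => (fockMass n : ℂ)⁻¹ * fockTransform f w :=
    (differentiable_fockTransform (Lp.memLp f).expIntegrable).const_mul _
  refine ⟨⟨_, hd, (memLp_congr_ae hae).1 (Lp.memLp f)⟩, ?_⟩
  exact Lp.ext ((Fock.toL2_ae_eq _).trans hae.symm)

instance : CompleteSpace (Fock n) := by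
  have h : IsUniformInducing (Fock.toL2 n) := (Fock.toL2 n).isometry.isUniformInducing
  rw [completeSpace_iff_isComplete_range h]
  exact Fock.isClosed_range_toL2.isComplete

end

section

variable {n p : ℕ}

/-! ### Polynomials in the Fock space -/

theorem exists_norm_eval_le (q : MvPolynomial (Fin n) ℂ) :
    ∃ C R : ℝ, 0 ≤ C ∧ 0 ≤ R ∧
      ∀ z : Fin n → ℂ, ‖MvPolynomial.eval z q‖ ≤ C * Real.exp (R * ∑ j, ‖z j‖) := by
  have hs : ∀ z : Fin n → ℂ, 0 ≤ ∑ j, ‖z j‖ := fun z => Finset.sum_nonneg fun _ _ => norm_nonneg _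
  induction q using MvPolynomial.induction_on with
  | C a => exact ⟨‖a‖, 0, norm_nonneg _, le_rfl, by simp⟩
  | add q r hq hr =>
    obtain ⟨C, R, hC, hR, hq⟩ := hq
    obtain ⟨D, S, hD, hS, hr⟩ := hr
    refine ⟨C + D, R + S, by positivity, by positivity, fun z => ?_⟩
    rw [map_add, add_mul]
    refine (norm_add_le _ _).trans (add_le_add ((hq z).trans ?_) ((hr z).trans ?_))
    · have := hs z
      gcongr
      linarith
    · have := hs z
      gcongr
      linarith
  | mul_X q i hq =>
    obtain ⟨C, R, hC, hR, hq⟩ := hq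
    refine ⟨C, R + 1, hC, by positivity, fun z => ?_⟩
    rw [map_mul, MvPolynomial.eval_X, norm_mul, add_mul, Real.exp_add, one_mul, ← mul_assoc]
    gcongr
    · exact hq z
    · exact norm_coord_le_exp z i

theorem differentiable_eval (q : MvPolynomial (Fin n) ℂ) :
    Differentiable ℂ fun z : Fin n → ℂ => MvPolynomial.eval z q := by
  induction q using MvPolynomial.induction_on with
  | C a => simp
  | add q r hq hr =>
    simp only [map_add]
    fun_prop
  | mul_X q i hq =>
    simp only [map_mul, MvPolynomial.eval_X]
    fun_prop

theorem memLp_eval (q : MvPolynomial (Fin n) ℂ) :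
    MemLp (fun z : Fin n → ℂ => MvPolynomial.eval z q) 2 (fockMeasure n) := by
  obtain ⟨C, R, hC, -, hq⟩ := exists_norm_eval_le q
  rw [memLp_two_iff_integrable_sq_norm (differentiable_eval q).continuous.aestronglyMeasurable]
  refine ((integrable_exp_sum_norm (2 * R)).const_mul (C ^ 2)).mono'
    ((differentiable_eval q).continuous.norm.pow 2).aestronglyMeasurable
    (Filter.Eventually.of_forall fun z => ?_)
  rw [Real.norm_eq_abs, abs_of_nonneg (sq_nonneg _)]
  calc _ ≤ (C * Real.exp (R * ∑ j, ‖z j‖)) ^ 2 := by gcongr; exact hq z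
    _ = _ := by rw [mul_pow, ← Real.exp_nat_mul]; push_cast; ring_nf

theorem partialZ_eval (j : Fin n) (q : MvPolynomial (Fin n) ℂ) (z : Fin n → ℂ) :
    partialZ j (fun z => MvPolynomial.eval z q) z =
      MvPolynomial.eval z (MvPolynomial.pderiv j q) := by
  induction q using MvPolynomial.induction_on with
  | C a => simp [partialZ]
  | add q r hq hr =>
    simp only [map_add, ← hq, ← hr, partialZ]
    rw [fderiv_fun_add (differentiable_eval q z) (differentiable_eval r z)]
    rfl
  | mul_X q i hq =>
    have hX : fderiv ℂ (fun z : Fin n → ℂ => z i) z = ContinuousLinearMap.proj i :=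
      (ContinuousLinearMap.proj (R := ℂ) (φ := fun _ : Fin n => ℂ) i).fderiv
    simp only [map_mul, MvPolynomial.eval_X, MvPolynomial.pderiv_mul, map_add, ← hq, partialZ]
    rw [fderiv_fun_mul (differentiable_eval q z) (by fun_prop), hX]
    by_cases h : i = j
    · subst h
      simp
      ring
    · simp [MvPolynomial.pderiv_X_of_ne h, h]
      ring

/-- Polynomials as elements of the Fock space. -/
def toFock (n : ℕ) : MvPolynomial (Fin n) ℂ →ₗ[ℂ] Fock n where
  toFun q := (⟨fun z => MvPolynomial.eval z q, differentiable_eval q, memLp_eval q⟩ :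
    fockSubmodule n)
  map_add' q r := Fock.ext fun z =>
    show MvPolynomial.eval z (q + r) = MvPolynomial.eval z q + MvPolynomial.eval z r from
      map_add _ q r
  map_smul' c q := Fock.ext fun z =>
    show MvPolynomial.eval z (c • q) = c * MvPolynomial.eval z q from MvPolynomial.smul_eval z q c

theorem partialZ_toFock (j : Fin n) (q : MvPolynomial (Fin n) ℂ) (z : Fin n → ℂ) :
    partialZ j (toFock n q) z = toFock n (MvPolynomial.pderiv j q) z :=
  partialZ_eval j q z

theorem toFock_injective : Function.Injective (toFock n) := fun _ _ h =>
  MvPolynomial.funext fun z => congrArg (fun f : Fock n => f z) h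

theorem inner_toFock (q : MvPolynomial (Fin n) ℂ) (f : Fock n) :
    inner ℂ (toFock n q) f = ∫ z, conj (MvPolynomial.eval z q) * f z ∂fockMeasure n := rfl

/-! ### Moments determine the transform -/

/-- Each factor `z̄_i` amounts to a derivative of the transform, and derivatives of zero vanish. -/
theorem fockTransform_conj_eval_mul {h : (Fin n → ℂ) → ℂ} (hh : ExpIntegrable h)
    (h0 : fockTransform h = 0) (q : MvPolynomial (Fin n) ℂ) :
    ExpIntegrable (fun z => conj (MvPolynomial.eval z q) * h z) ∧
      fockTransform (fun z => conj (MvPolynomial.eval z q) * h z) = 0 := by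
  induction q using MvPolynomial.induction_on with
  | C a =>
    simp only [MvPolynomial.eval_C]
    refine ⟨hh.const_mul _, funext fun w => ?_⟩
    simp [fockTransform_const_mul, h0]
  | add q r hq hr =>
    simp only [map_add, add_mul]
    refine ⟨hq.1.add hr.1, funext fun w => ?_⟩
    have h1 := congrFun hq.2 w
    have h2 := congrFun hr.2 w
    simp only [fockTransform, mul_add] at h1 h2 ⊢
    rw [integral_add (hq.1.exp_mul w).integrable (hr.1.exp_mul w).integrable, h1, h2]
    simp
  | mul_X q i hq =>
    have he : (fun z : Fin n → ℂ => conj (MvPolynomial.eval z (q * MvPolynomial.X i)) * h z) =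
        fun z => conj (z i) * (conj (MvPolynomial.eval z q) * h z) := by
      ext z
      simp only [map_mul, MvPolynomial.eval_X]
      ring
    rw [he]
    refine ⟨hq.1.conj_coord_mul i, funext fun w => ?_⟩
    rw [← partialZ_fockTransform hq.1, hq.2]
    simp [partialZ]

/-- The moments are the derivatives of the transform at `0`; conversely, expanding `e^{w·z̄}` in its
power series writes the transform as a sum of moments, with `e^{‖w‖ ∑ |z_j|} |h|` as majorant. -/
theorem fockTransform_eq_zero_iff {h : (Fin n → ℂ) → ℂ} (hh : ExpIntegrable h) :
    fockTransform h = 0 ↔ ∀ q : MvPolynomial (Fin n) ℂ,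
      ∫ z, conj (MvPolynomial.eval z q) * h z ∂fockMeasure n = 0 := by
  refine ⟨fun h0 q => ?_, fun hq => funext fun w => ?_⟩
  · simpa [fockTransform] using congrFun (fockTransform_conj_eval_mul hh h0 q).2 0
  · have hsum := hasSum_integral_of_dominated_convergence (μ := fockMeasure n)
      (F := fun (k : ℕ) z => (∑ j, w j * conj (z j)) ^ k / (k.factorial : ℂ) * h z)
      (f := fun z => Complex.exp (∑ j, w j * conj (z j)) * h z)
      (bound := fun k z => (‖w‖ * ∑ j, ‖z j‖) ^ k / (k.factorial : ℝ) * ‖h z‖)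
      (fun k => (Continuous.aestronglyMeasurable (by fun_prop)).mul hh.integrable.1)
      (fun k => Filter.Eventually.of_forall fun z => ?_)
      (Filter.Eventually.of_forall fun z => (Real.summable_pow_div_factorial _).mul_right _)
      ?_ (Filter.Eventually.of_forall fun z => ?_)
    · refine hsum.unique ?_
      have h0 : ∀ k : ℕ, ∫ z, (∑ j, w j * conj (z j)) ^ k / (k.factorial : ℂ) * h z
          ∂fockMeasure n = 0 := fun k => by
        -- The polynomial whose conjugate is `(w·z̄)^k / k!`.
        rw [← hq (MvPolynomial.C (k.factorial : ℂ)⁻¹ *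
          (∑ j, MvPolynomial.C (conj (w j)) * MvPolynomial.X j) ^ k)]
        refine integral_congr_ae (Filter.Eventually.of_forall fun z => ?_)
        simp [div_eq_inv_mul]
      simp only [h0]
      exact hasSum_zero
    · rw [norm_mul, norm_div, norm_pow, Complex.norm_natCast]
      gcongr
      rw [Finset.mul_sum]
      refine (norm_sum_le _ _).trans (Finset.sum_le_sum fun j _ => ?_)
      rw [norm_mul, RCLike.norm_conj]
      gcongr
      exact norm_le_pi_norm w j
    · refine (hh ‖w‖).norm.congr (Filter.Eventually.of_forall fun z => ?_)
      simp only [tsum_mul_right]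
      rw [norm_smul, Real.norm_eq_abs, Real.abs_exp, Real.exp_eq_exp_ℝ,
        NormedSpace.exp_eq_tsum_div]
    · refine HasSum.mul_right _ ?_
      rw [Complex.exp_eq_exp_ℂ]
      exact NormedSpace.expSeries_div_hasSum_exp _

theorem Fock.eq_zero_of_inner_toFock {f : Fock n}
    (hf : ∀ q, inner ℂ (toFock n q) f = 0) : f = 0 := by
  have h := (fockTransform_eq_zero_iff f.expIntegrable).2 hf
  ext w
  have hw := congrFun h w
  rw [f.fockTransform_eq] at hw
  exact (mul_eq_zero.1 hw).resolve_left (by exact_mod_cast (fockMass_pos n).ne')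

theorem conj_wedgeCoeff (j : Fin n) (J K : Finset (Fin n)) :
    conj (wedgeCoeff j J K) = wedgeCoeff j J K := by
  unfold wedgeCoeff
  split_ifs <;> simp

/-- The graph of `∂` in terms of moments. -/
theorem mem_delGraph_iff (f : Forms n p) (g : Forms n (p + 1)) :
    (f, g) ∈ delGraph n p ↔ ∀ (K : MultiIndex n (p + 1)) (q : MvPolynomial (Fin n) ℂ),
      inner ℂ (toFock n q) (g K) = ∑ J : MultiIndex n p, ∑ j : Fin n,
        wedgeCoeff j J.1 K.1 * inner ℂ (toFock n (MvPolynomial.X j * q)) (f J) := by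
  have hM : (fockMass n : ℂ) ≠ 0 := by exact_mod_cast (fockMass_pos n).ne'
  refine forall_congr' fun K => ?_
  have hF : ∀ (J : MultiIndex n p) (j : Fin n),
      ExpIntegrable fun z => wedgeCoeff j J.1 K.1 * (conj (z j) * f J z) :=
    fun J j => ((f J).expIntegrable.conj_coord_mul j).const_mul _
  have hS : ExpIntegrable fun z => ∑ J : MultiIndex n p, ∑ j : Fin n,
      wedgeCoeff j J.1 K.1 * (conj (z j) * f J z) :=
    ExpIntegrable.sum _ fun J => ExpIntegrable.sum _ fun j => hF J j
  -- The transform measures the failure of `g = ∂f` in the component `K`. The coefficients of `∂f`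
  -- need not be square integrable here, so the sum is formed from `z̄_j f_J`, which is always
  -- `ExpIntegrable`.
  have hT : ∀ z, fockTransform (fun z => g K z - ∑ J : MultiIndex n p, ∑ j : Fin n,
      wedgeCoeff j J.1 K.1 * (conj (z j) * f J z)) z =
      fockMass n * (g K z - delCoeff f K z) := fun z => by
    rw [fockTransform_sub (g K).expIntegrable hS, (g K).fockTransform_eq, mul_sub,
      fockTransform_sum _ fun J => ExpIntegrable.sum _ fun j => hF J j, delCoeff, Finset.mul_sum]
    congr 1
    refine Finset.sum_congr rfl fun J _ => ?_
    rw [fockTransform_sum _ (hF J), Finset.mul_sum]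
    refine Finset.sum_congr rfl fun j _ => ?_
    rw [fockTransform_const_mul, Fock.fockTransform_conj_coord_mul]
    ring
  have h1 : (∀ z, g K z = delCoeff f K z) ↔ fockTransform (fun z => g K z -
      ∑ J : MultiIndex n p, ∑ j : Fin n, wedgeCoeff j J.1 K.1 * (conj (z j) * f J z)) = 0 := by
    rw [funext_iff]
    refine forall_congr' fun z => ?_
    rw [hT z, Pi.zero_apply, mul_eq_zero, or_iff_right hM, sub_eq_zero]
  refine h1.trans ((fockTransform_eq_zero_iff ((g K).expIntegrable.sub hS)).trans
    (forall_congr' fun q => ?_))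
  have hq : ∀ {h : (Fin n → ℂ) → ℂ}, ExpIntegrable h →
      Integrable (fun z => conj (MvPolynomial.eval z q) * h z) (fockMeasure n) := fun hh => by
    obtain ⟨C, R, -, -, hb⟩ := exists_norm_eval_le q
    exact (hh.mul_of_bound (g := fun z => conj (MvPolynomial.eval z q))
      (Complex.continuous_conj.comp (differentiable_eval q).continuous)
      (by simpa using hb)).integrable
  simp only [mul_sub]
  rw [integral_sub (hq (g K).expIntegrable) (hq hS), sub_eq_zero, inner_toFock]
  simp only [Finset.mul_sum]
  rw [integral_finsetSum _ fun J _ => integrable_finsetSum _ fun j _ => hq (hF J j)]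
  refine Eq.congr_right (Finset.sum_congr rfl fun J _ => ?_)
  rw [integral_finsetSum _ fun j _ => hq (hF J j)]
  refine Finset.sum_congr rfl fun j _ => ?_
  rw [inner_toFock, ← integral_const_mul]
  refine integral_congr_ae (Filter.Eventually.of_forall fun z => ?_)
  simp only [map_mul, MvPolynomial.eval_X]
  ring

end

section

variable {n p : ℕ}

/-! ### Signs of exterior products -/

/-- The sign of `dz_j ∧ dz_J`. -/
def wedgeSign (j : Fin n) (J : Finset (Fin n)) : ℂ := (-1) ^ (J.filter (· < j)).card

theorem wedgeSign_insert {i j : Fin n} {J : Finset (Fin n)} (h : j ∉ J) :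
    wedgeSign i (insert j J) = wedgeSign i J * if j < i then -1 else 1 := by
  unfold wedgeSign
  rw [Finset.filter_insert]
  split_ifs with hji
  · rw [Finset.card_insert_of_notMem (by simp [h]), pow_succ]
  · rw [mul_one]

theorem wedgeSign_mul_self (j : Fin n) (J : Finset (Fin n)) :
    wedgeSign j J * wedgeSign j J = 1 := by
  rw [wedgeSign, ← mul_pow]
  simp

theorem wedgeCoeff_eq (j : Fin n) (J K : Finset (Fin n)) :
    wedgeCoeff j J K = if j ∉ J ∧ insert j J = K then wedgeSign j J else 0 := rfl

theorem card_of_wedgeCoeff_ne_zero {j : Fin n} {J K : Finset (Fin n)} (h : wedgeCoeff j J K ≠ 0) :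
    K.card = J.card + 1 := by
  rw [wedgeCoeff_eq, ne_eq, ite_eq_right_iff, not_forall] at h
  obtain ⟨⟨h1, rfl⟩, -⟩ := h
  exact Finset.card_insert_of_notMem h1

/-- Allows the sign identities to be stated over all subsets, without tracking cardinalities. -/
theorem sum_multiIndex {M : Type*} [AddCommMonoid M] (F : Finset (Fin n) → M)
    (hF : ∀ J, F J ≠ 0 → J.card = p) : ∑ J : MultiIndex n p, F J.1 = ∑ J, F J := by
  rw [← Finset.sum_filter_of_ne (p := fun J => J.card = p) fun J _ h => hF J h]
  exact (Finset.sum_subtype _ (by simp) F).symm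

theorem sum_wedgeCoeff_mul (j : Fin n) (J : Finset (Fin n)) (F : Finset (Fin n) → ℂ) :
    ∑ K, wedgeCoeff j J K * F K = if j ∈ J then 0 else wedgeSign j J * F (insert j J) := by
  rw [Finset.sum_eq_single (insert j J)]
  · by_cases h : j ∈ J <;> simp [wedgeCoeff_eq, h]
  · intro K _ hK
    rw [wedgeCoeff_eq, if_neg fun h => hK h.2.symm, zero_mul]
  · simp

theorem sum_wedgeCoeff_mul' (j : Fin n) (J : Finset (Fin n)) (F : Finset (Fin n) → ℂ) :
    ∑ I, wedgeCoeff j I J * F I =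
      if j ∈ J then wedgeSign j (J.erase j) * F (J.erase j) else 0 := by
  rw [Finset.sum_eq_single (J.erase j)]
  · by_cases h : j ∈ J
    · simp [wedgeCoeff_eq, h]
    · have : insert j J ≠ J := fun h' => h (h' ▸ Finset.mem_insert_self j J)
      simp [wedgeCoeff_eq, h, this]
  · intro I _ hI
    rw [wedgeCoeff_eq, if_neg ?_, zero_mul]
    rintro ⟨h1, rfl⟩
    exact hI (Finset.erase_insert h1).symm
  · simp

/-- Exactly one of `i < j` and `j < i` holds, so exactly one of the two insertions changes a sign.
-/
theorem wedgeSign_swap {i j : Fin n} (hij : i ≠ j) {J : Finset (Fin n)} (hi : i ∉ J) (hj : j ∉ J) :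
    wedgeSign i (insert j J) * wedgeSign j (insert i J) = -(wedgeSign i J * wedgeSign j J) := by
  rw [wedgeSign_insert hj, wedgeSign_insert hi]
  rcases lt_or_gt_of_ne hij with h | h
  · rw [if_neg h.not_gt, if_pos h]
    ring
  · rw [if_neg h.not_gt, if_pos h]
    ring

theorem wedgeSign_swap' {i j : Fin n} (hij : i ≠ j) {J : Finset (Fin n)} (hi : i ∉ J)
    (hj : j ∉ J) :
    wedgeSign j J * wedgeSign i (insert j J) = -(wedgeSign i J * wedgeSign j (insert i J)) := by
  rw [wedgeSign_insert hj, wedgeSign_insert hi]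
  rcases lt_or_gt_of_ne hij with h | h
  · rw [if_neg h.not_gt, if_pos h]
    ring
  · rw [if_neg h.not_gt, if_pos h]
    ring

/-- The exterior products by `dz_i` and `dz_j` anticommute. -/
theorem sum_wedgeCoeff_anticomm (i j : Fin n) (J L : Finset (Fin n)) :
    ∑ K, wedgeCoeff j J K * wedgeCoeff i K L = -∑ K, wedgeCoeff i J K * wedgeCoeff j K L := by
  rw [sum_wedgeCoeff_mul, sum_wedgeCoeff_mul, wedgeCoeff_eq, wedgeCoeff_eq]
  by_cases hij : i = j
  · subst hij
    simp
  by_cases hi : i ∈ J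
  · simp [hi]
  by_cases hj : j ∈ J
  · simp [hj]
  have hji : j ≠ i := fun h => hij h.symm
  simp only [hi, hj, if_false, Finset.mem_insert, hij, hji, or_self, not_false_eq_true, true_and,
    Finset.insert_comm j i]
  split_ifs
  · exact wedgeSign_swap' hij hi hj
  · simp

/-- The canonical anticommutation relations of exterior and interior products. -/
theorem sum_wedgeCoeff_car (i j : Fin n) (J J' : Finset (Fin n)) :
    ∑ K, wedgeCoeff i J K * wedgeCoeff j J' K + ∑ I, wedgeCoeff j I J * wedgeCoeff i I J' =
      if i = j ∧ J = J' then 1 else 0 := by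
  rw [sum_wedgeCoeff_mul, sum_wedgeCoeff_mul', wedgeCoeff_eq, wedgeCoeff_eq]
  by_cases hij : i = j
  · subst hij
    by_cases hi : i ∈ J
    · by_cases hJ : J = J'
      · subst hJ
        simp [hi, wedgeSign_mul_self]
      · simp [hi, hJ]
    · by_cases hJ : J = J'
      · subst hJ
        simp [hi, wedgeSign_mul_self]
      · have : ¬ (i ∉ J' ∧ insert i J' = insert i J) := fun h => hJ (by
          rw [← Finset.erase_insert hi, ← h.2, Finset.erase_insert h.1])
        simp [hi, hJ, this]
  · simp only [hij, false_and, if_false]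
    have hji : j ≠ i := fun h => hij h.symm
    by_cases hj : j ∈ J
    · obtain ⟨I, hI, rfl⟩ : ∃ I, j ∉ I ∧ insert j I = J :=
        ⟨J.erase j, by simp, Finset.insert_erase hj⟩
      rw [if_pos hj, Finset.erase_insert hI]
      by_cases hi : i ∈ I
      · simp [hi]
      · by_cases hJ : insert i I = J'
        · subst hJ
          simp only [Finset.mem_insert, hi, hij, hji, hI, or_self, if_false, not_false_eq_true,
            true_and, if_true, Finset.insert_comm i j]
          rw [wedgeSign_swap hij hi hI]
          ring
        · have : ¬ (j ∉ J' ∧ insert j J' = insert i (insert j I)) := fun h => hJ (by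
            rw [Finset.insert_comm] at h
            rw [← Finset.erase_insert h.1, h.2, Finset.erase_insert]
            simp [hji, hI])
          simp [hi, hij, hJ, this]
    · have : insert j J' ≠ insert i J := fun h => hj (by
        have h1 : j ∈ insert i J := h ▸ Finset.mem_insert_self j J'
        exact (Finset.mem_insert.1 h1).resolve_left hji)
      simp [hj, this]

/-- Exterior after interior product by `dz_i` projects onto the `dz_J` with `i ∈ J`. Summed over
`i`, this counts the elements of `J` and produces the shift by `p` in the spectrum. -/
theorem sum_wedgeCoeff_number (i : Fin n) (J J' : Finset (Fin n)) :
    ∑ I, wedgeCoeff i I J * wedgeCoeff i I J' = if i ∈ J ∧ J = J' then 1 else 0 := by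
  rw [sum_wedgeCoeff_mul', wedgeCoeff_eq]
  by_cases hi : i ∈ J
  · by_cases hJ : J = J'
    · subst hJ
      simp [hi, wedgeSign_mul_self]
    · simp [hi, hJ]
  · simp [hi]

/-! ### Forms with polynomial coefficients -/

/-- `(p,0)`-forms with polynomial coefficients. -/
abbrev PolyForms (n p : ℕ) : Type := MultiIndex n p → MvPolynomial (Fin n) ℂ

/-- The operator `∂` on polynomial forms. -/
def polyDel (n p : ℕ) : PolyForms n p →ₗ[ℂ] PolyForms n (p + 1) where
  toFun q K := ∑ J : MultiIndex n p, ∑ j : Fin n,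
    wedgeCoeff j J.1 K.1 • MvPolynomial.pderiv j (q J)
  map_add' q r := by
    ext1 K
    simp [Finset.sum_add_distrib]
  map_smul' c q := by
    ext1 K
    simp [Finset.smul_sum, smul_comm c]

/-- The formal adjoint of `∂` on polynomial forms: multiplication by `z_j` and contraction. -/
def polyDelStar (n p : ℕ) : PolyForms n (p + 1) →ₗ[ℂ] PolyForms n p where
  toFun q J := ∑ K : MultiIndex n (p + 1), ∑ j : Fin n,
    wedgeCoeff j J.1 K.1 • (MvPolynomial.X j * q K)
  map_add' q r := by
    ext1 K
    simp [Finset.sum_add_distrib, mul_add]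
  map_smul' c q := by
    ext1 K
    simp [Finset.smul_sum, smul_comm c]

theorem polyDel_apply (q : PolyForms n p) (K : MultiIndex n (p + 1)) :
    polyDel n p q K = ∑ J : MultiIndex n p, ∑ j : Fin n,
      wedgeCoeff j J.1 K.1 • MvPolynomial.pderiv j (q J) := rfl

theorem polyDelStar_apply (q : PolyForms n (p + 1)) (J : MultiIndex n p) :
    polyDelStar n p q J = ∑ K : MultiIndex n (p + 1), ∑ j : Fin n,
      wedgeCoeff j J.1 K.1 • (MvPolynomial.X j * q K) := rfl

/-! ### Algebra of the polynomial complex: `∂² = 0` and the Laplacian -/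

theorem pderiv_comm (i j : Fin n) (q : MvPolynomial (Fin n) ℂ) :
    MvPolynomial.pderiv i (MvPolynomial.pderiv j q) =
      MvPolynomial.pderiv j (MvPolynomial.pderiv i q) := by
  induction q using MvPolynomial.induction_on with
  | C a => simp
  | add q r hq hr => simp [hq, hr]
  | mul_X q k hq =>
    have h : ∀ i j : Fin n, MvPolynomial.pderiv i
        (MvPolynomial.pderiv j (MvPolynomial.X k : MvPolynomial (Fin n) ℂ)) = 0 := fun i j => by
      by_cases hj : k = j
      · subst hj
        simp
      · simp [MvPolynomial.pderiv_X_of_ne hj]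
    simp only [MvPolynomial.pderiv_mul, map_add, hq, h]
    ring

theorem sum_multiIndex_wedgeCoeff (j : Fin n) (J : MultiIndex n p) (F : Finset (Fin n) → ℂ) :
    ∑ K : MultiIndex n (p + 1), wedgeCoeff j J.1 K.1 * F K.1 = ∑ K, wedgeCoeff j J.1 K * F K :=
  sum_multiIndex (fun K => wedgeCoeff j J.1 K * F K) fun K hK => by
    rw [card_of_wedgeCoeff_ne_zero (left_ne_zero_of_mul hK), J.2]

theorem sum_multiIndex_wedgeCoeff' (j : Fin n) (J : MultiIndex n (p + 1))
    (F : Finset (Fin n) → ℂ) :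
    ∑ I : MultiIndex n p, wedgeCoeff j I.1 J.1 * F I.1 = ∑ I, wedgeCoeff j I J.1 * F I :=
  sum_multiIndex (fun I => wedgeCoeff j I J.1 * F I) fun I hI => by
    have := card_of_wedgeCoeff_ne_zero (left_ne_zero_of_mul hI)
    rw [J.2] at this
    omega

theorem polyDel_polyDel (q : PolyForms n p) : polyDel n (p + 1) (polyDel n p q) = 0 := by
  ext1 L
  have h1 : polyDel n (p + 1) (polyDel n p q) L = ∑ J : MultiIndex n p, ∑ i, ∑ j,
      (∑ K, wedgeCoeff j J.1 K * wedgeCoeff i K L.1) •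
        MvPolynomial.pderiv i (MvPolynomial.pderiv j (q J)) := by
    simp only [polyDel_apply, map_sum, Derivation.map_smul, Finset.smul_sum, smul_smul]
    rw [Finset.sum_comm' (t' := Finset.univ) (s' := fun _ => Finset.univ) (by simp)]
    have : ∀ (i : Fin n), ∑ K : MultiIndex n (p + 1), ∑ J : MultiIndex n p, ∑ j,
        (wedgeCoeff i K.1 L.1 * wedgeCoeff j J.1 K.1) •
          MvPolynomial.pderiv i (MvPolynomial.pderiv j (q J)) =
        ∑ J : MultiIndex n p, ∑ j, (∑ K, wedgeCoeff j J.1 K * wedgeCoeff i K L.1) •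
          MvPolynomial.pderiv i (MvPolynomial.pderiv j (q J)) := fun i => by
      rw [Finset.sum_comm]
      refine Finset.sum_congr rfl fun J _ => ?_
      rw [Finset.sum_comm]
      refine Finset.sum_congr rfl fun j _ => ?_
      rw [← Finset.sum_smul, ← sum_multiIndex_wedgeCoeff]
      simp only [mul_comm]
    simp only [this]
    rw [Finset.sum_comm]
  have h2 : ∀ J : MultiIndex n p, ∑ i, ∑ j,
      (∑ K, wedgeCoeff j J.1 K * wedgeCoeff i K L.1) •
        MvPolynomial.pderiv i (MvPolynomial.pderiv j (q J)) = 0 := fun J => by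
    -- Second derivatives are symmetric in `i, j` and the coefficients antisymmetric, so exchanging
    -- the indices negates the sum.
    rw [← self_eq_neg]
    conv_lhs => rw [Finset.sum_comm]
    rw [← Finset.sum_neg_distrib]
    refine Finset.sum_congr rfl fun i _ => ?_
    rw [← Finset.sum_neg_distrib]
    refine Finset.sum_congr rfl fun j _ => ?_
    rw [sum_wedgeCoeff_anticomm, pderiv_comm, neg_smul]
  rw [h1, Finset.sum_eq_zero fun J _ => h2 J, Pi.zero_apply]

theorem polyDelStar_polyDel_apply (q : PolyForms n p) (J : MultiIndex n p) :
    polyDelStar n p (polyDel n p q) J = ∑ J' : MultiIndex n p, ∑ i, ∑ j,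
      (∑ K, wedgeCoeff i J.1 K * wedgeCoeff j J'.1 K) •
        (MvPolynomial.X i * MvPolynomial.pderiv j (q J')) := by
  simp only [polyDelStar_apply, polyDel_apply, Finset.mul_sum, mul_smul_comm, Finset.smul_sum,
    smul_smul]
  rw [Finset.sum_comm, Finset.sum_comm (s := Finset.univ (α := MultiIndex n p))]
  refine Finset.sum_congr rfl fun i _ => ?_
  rw [Finset.sum_comm]
  refine Finset.sum_congr rfl fun J' _ => ?_
  rw [Finset.sum_comm]
  refine Finset.sum_congr rfl fun j _ => ?_
  rw [← Finset.sum_smul, sum_multiIndex_wedgeCoeff i J fun K => wedgeCoeff j J'.1 K]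

theorem polyDel_polyDelStar_apply (q : PolyForms n (p + 1)) (J : MultiIndex n (p + 1)) :
    polyDel n p (polyDelStar n p q) J = ∑ J' : MultiIndex n (p + 1), ∑ i, ∑ j,
      (∑ I, wedgeCoeff j I J.1 * wedgeCoeff i I J'.1) •
        MvPolynomial.pderiv j (MvPolynomial.X i * q J') := by
  simp only [polyDelStar_apply, polyDel_apply, map_sum, Derivation.map_smul, Finset.smul_sum,
    smul_smul]
  conv_rhs =>
    enter [2, J']
    rw [Finset.sum_comm]
  rw [Finset.sum_comm, Finset.sum_comm (s := Finset.univ (α := MultiIndex n (p + 1)))]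
  refine Finset.sum_congr rfl fun j _ => ?_
  rw [Finset.sum_comm]
  refine Finset.sum_congr rfl fun J' _ => ?_
  rw [Finset.sum_comm]
  refine Finset.sum_congr rfl fun i _ => ?_
  rw [← Finset.sum_smul, sum_multiIndex_wedgeCoeff' j J fun I => wedgeCoeff i I J'.1]

theorem sum_car_smul (J : MultiIndex n p) (F : MultiIndex n p → Fin n → Fin n →
    MvPolynomial (Fin n) ℂ) :
    ∑ J' : MultiIndex n p, ∑ i, ∑ j,
      (if i = j ∧ J.1 = J'.1 then (1 : ℂ) else 0) • F J' i j = ∑ i, F J i i := by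
  rw [Finset.sum_eq_single J]
  · simp
  · intro J' _ h
    have : J.1 ≠ J'.1 := fun h' => h (Subtype.ext h'.symm)
    simp [this]
  · simp

theorem polyLaplacian_zero (q : PolyForms n 0) (J : MultiIndex n 0) :
    polyDelStar n 0 (polyDel n 0 q) J =
      ∑ i, MvPolynomial.X i * MvPolynomial.pderiv i (q J) := by
  rw [polyDelStar_polyDel_apply,
    ← sum_car_smul J fun J' i j => MvPolynomial.X i * MvPolynomial.pderiv j (q J')]
  refine Finset.sum_congr rfl fun J' _ => Finset.sum_congr rfl fun i _ =>
    Finset.sum_congr rfl fun j _ => ?_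
  -- Since `J` is empty, the interior products vanish and the exterior half of the anticommutation
  -- relation is already the identity.
  rw [← sum_wedgeCoeff_car i j, Finset.sum_eq_zero (f := fun I => wedgeCoeff j I J.1 * _), add_zero]
  intro I _
  by_contra h
  have := card_of_wedgeCoeff_ne_zero (left_ne_zero_of_mul h)
  rw [J.2] at this
  omega

/-- Commuting `∂_j` past `z_i` leaves `z_i ∂_j` terms in both halves, which the anticommutation
relations collapse to the Euler operator, and `δ_ij` terms, which form the number operator with
value `|J| = p + 1`. -/
theorem polyLaplacian_succ (q : PolyForms n (p + 1)) (J : MultiIndex n (p + 1)) :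
    polyDelStar n (p + 1) (polyDel n (p + 1) q) J + polyDel n p (polyDelStar n p q) J =
      ∑ i, MvPolynomial.X i * MvPolynomial.pderiv i (q J) + ((p + 1 : ℕ) : ℂ) • q J := by
  have h1 : ∀ (J' : MultiIndex n (p + 1)) (i j : Fin n),
      MvPolynomial.pderiv j (MvPolynomial.X i * q J') =
        MvPolynomial.X i * MvPolynomial.pderiv j (q J') + (if i = j then (1 : ℂ) else 0) • q J' :=
    fun J' i j => by
      rw [MvPolynomial.pderiv_mul, add_comm]
      by_cases h : i = j
      · subst h
        simp
      · simp [MvPolynomial.pderiv_X_of_ne h, h]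
  rw [polyDelStar_polyDel_apply, polyDel_polyDelStar_apply,
    ← sum_car_smul J fun J' i j => MvPolynomial.X i * MvPolynomial.pderiv j (q J')]
  simp only [h1, smul_add, Finset.sum_add_distrib, ← sum_wedgeCoeff_car, add_smul]
  rw [add_assoc, add_left_cancel_iff, add_left_cancel_iff]
  simp only [ite_smul, smul_ite, one_smul, zero_smul, smul_zero, Finset.sum_ite_eq,
    Finset.mem_univ, if_true]
  simp only [sum_wedgeCoeff_number]
  rw [Finset.sum_eq_single J]
  · simp [J.2, MvPolynomial.smul_eq_C_mul]
  · intro J' _ h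
    have : J.1 ≠ J'.1 := fun h' => h (Subtype.ext h'.symm)
    simp [this]
  · simp

end

/-! ### Operators that are diagonal in an orthogonal decomposition -/

section Diagonal

open Filter Topology

variable {H : Type*} [NormedAddCommGroup H] [InnerProductSpace ℂ H]

/-- An orthogonal sequence of subspaces with dense span. -/
structure IsOrthogonalDecomposition (V : ℕ → Submodule ℂ H) : Prop where
  orthogonal : ∀ m k, m ≠ k → ∀ v ∈ V m, ∀ w ∈ V k, inner ℂ v w = 0
  total : ∀ x : H, (∀ m, ∀ v ∈ V m, inner ℂ v x = 0) → x = 0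

namespace IsOrthogonalDecomposition

variable {V : ℕ → Submodule ℂ H}

theorem ext (hV : IsOrthogonalDecomposition V) {x y : H}
    (h : ∀ m, ∀ v ∈ V m, inner ℂ v x = inner ℂ v y) : x = y :=
  sub_eq_zero.1 (hV.total _ fun m v hv => by rw [inner_sub_right, h m v hv, sub_self])

theorem orthogonalFamily (hV : IsOrthogonalDecomposition V) :
    OrthogonalFamily ℂ (fun m => V m) fun m => (V m).subtypeₗᵢ :=
  fun m k h v w => hV.orthogonal m k h v v.2 w w.2

variable [∀ m, FiniteDimensional ℂ (V m)]

theorem inner_starProjection (hV : IsOrthogonalDecomposition V) {m k : ℕ} {v : H} (hv : v ∈ V m)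
    (x : H) : inner ℂ v ((V k).starProjection x) = if k = m then inner ℂ v x else 0 := by
  split_ifs with h
  · subst h
    rw [← Submodule.inner_starProjection_left_eq_right, Submodule.starProjection_eq_self_iff.2 hv]
  · exact hV.orthogonal m k (fun h' => h h'.symm) v hv _ (Submodule.starProjection_apply_mem _ _)

theorem norm_sq_sum (hV : IsOrthogonalDecomposition V) (c : ℕ → ℂ) (s : Finset ℕ) (x : H) :
    ‖∑ m ∈ s, c m • (V m).starProjection x‖ ^ 2 =
      ∑ m ∈ s, ‖c m‖ ^ 2 * ‖(V m).starProjection x‖ ^ 2 := by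
  have h := hV.orthogonalFamily.norm_sum
    (fun m => c m • ⟨(V m).starProjection x, Submodule.starProjection_apply_mem _ _⟩) s
  simpa [norm_smul, mul_pow] using h

theorem sum_norm_sq_le (hV : IsOrthogonalDecomposition V) (s : Finset ℕ) (x : H) :
    ∑ m ∈ s, ‖(V m).starProjection x‖ ^ 2 ≤ ‖x‖ ^ 2 := by
  set y := ∑ m ∈ s, (V m).starProjection x with hy
  have h1 : ‖y‖ ^ 2 = ∑ m ∈ s, ‖(V m).starProjection x‖ ^ 2 := by
    simpa using hV.norm_sq_sum (fun _ => 1) s x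
  have h2 : (inner ℂ y x : ℂ).re = ‖y‖ ^ 2 := by
    rw [h1, hy, sum_inner, Complex.re_sum]
    exact Finset.sum_congr rfl fun m _ => (V m).re_inner_starProjection_eq_normSq x
  have h3 : ‖y‖ ^ 2 ≤ ‖y‖ * ‖x‖ := by
    rw [← h2]
    exact (Complex.re_le_norm _).trans (norm_inner_le_norm _ _)
  have h4 : ‖y‖ ≤ ‖x‖ := by
    by_contra h
    push Not at h
    nlinarith [norm_nonneg x, norm_nonneg y]
  rw [← h1]
  gcongr

theorem norm_sum_smul_starProjection_le (hV : IsOrthogonalDecomposition V) {c : ℕ → ℂ}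
    {s : Finset ℕ} {ε : ℝ} (hε : 0 ≤ ε) (hc : ∀ m ∈ s, ‖c m‖ ≤ ε) :
    ‖∑ m ∈ s, c m • (V m).starProjection‖ ≤ ε := by
  refine ContinuousLinearMap.opNorm_le_bound _ hε fun x => ?_
  refine le_of_sq_le_sq ?_ (by positivity)
  rw [sum_apply]
  simp only [smul_apply]
  rw [hV.norm_sq_sum, mul_pow]
  calc _ ≤ ∑ m ∈ s, ε ^ 2 * ‖(V m).starProjection x‖ ^ 2 := by
        gcongr with m hm
        exact hc m hm
    _ ≤ _ := by
        rw [← Finset.mul_sum]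
        gcongr
        exact hV.sum_norm_sq_le s x

theorem isCompactOperator_starProjection (m : ℕ) :
    IsCompactOperator ((V m).starProjection : H → H) := by
  have : ProperSpace (V m) := FiniteDimensional.proper ℂ (V m)
  have h : IsCompactOperator (Submodule.orthogonalProjectionOnto (V m)) :=
    isCompactOperator_of_locallyCompactSpace_dom (Submodule.orthogonalProjectionOnto (V m))
  exact h.clm_comp (V m).subtypeL

variable [CompleteSpace H]

theorem hasSum_starProjection (hV : IsOrthogonalDecomposition V) (x : H) :
    HasSum (fun m => (V m).starProjection x) x := by
  have hs : Summable fun m => (V m).starProjection x := by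
    refine (hV.orthogonalFamily.summable_iff_norm_sq_summable
      (fun m => ⟨(V m).starProjection x, Submodule.starProjection_apply_mem _ _⟩)).2 ?_
    exact summable_of_sum_le (fun _ => sq_nonneg _) fun s => hV.sum_norm_sq_le s x
  convert hs.hasSum
  refine hV.ext fun m v hv => ?_
  have h1 := hs.hasSum.mapL (innerSL ℂ v)
  simp only [innerSL_apply_apply, hV.inner_starProjection hv] at h1
  exact (hasSum_ite_eq m (inner ℂ v x)).unique h1

/-- The series `∑ c_m P_m` of projections converges in operator norm, since a finite sum has norm at
most the largest `|c_m|` in it. Its partial sums have finite rank, so the limit is compact. -/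
theorem exists_isCompactOperator (hV : IsOrthogonalDecomposition V) {c : ℕ → ℂ}
    (hc : Tendsto c atTop (𝓝 0)) : ∃ R : H →L[ℂ] H, IsCompactOperator R ∧
      ∀ m, ∀ v ∈ V m, ∀ x, inner ℂ v (R x) = c m * inner ℂ v x := by
  have hs : Summable fun m => c m • (V m).starProjection := by
    rw [summable_iff_vanishing_norm]
    intro ε hε
    obtain ⟨N, hN⟩ := Metric.tendsto_atTop.1 hc (ε / 2) (by positivity)
    refine ⟨Finset.range N, fun t ht => ?_⟩
    refine (hV.norm_sum_smul_starProjection_le (by positivity) fun m hm => ?_).trans_lt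
      (half_lt_self hε)
    have hmN : N ≤ m := by
      by_contra h
      exact Finset.disjoint_left.1 ht hm (Finset.mem_range.2 (not_le.1 h))
    simpa using (hN m hmN).le
  refine ⟨∑' m, c m • (V m).starProjection, ?_, fun m v hv x => ?_⟩
  · refine isCompactOperator_of_tendsto hs.hasSum (Eventually.of_forall fun s => ?_)
    exact sum_mem (S := compactOperator (RingHom.id ℂ) H H)
      fun m _ => (isCompactOperator_starProjection m).smul (c m)
  · have h1 := (hs.hasSum.mapL (ContinuousLinearMap.apply ℂ H x)).mapL (innerSL ℂ v)
    simp only [innerSL_apply_apply, ContinuousLinearMap.apply_apply, smul_apply, inner_smul_right,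
      hV.inner_starProjection hv, mul_ite, mul_zero] at h1
    refine h1.unique ?_
    have h2 : (fun k => if k = m then c k * inner ℂ v x else 0) =
        fun k => if k = m then c m * inner ℂ v x else 0 := by
      ext k
      split_ifs with h
      · rw [h]
      · rfl
    rw [h2]
    exact hasSum_ite_eq m _

end IsOrthogonalDecomposition

/-- The operator `T` acts on `V m` as multiplication by `lam m`, with its maximal domain. -/
def IsDiagonal (T : H →ₗ.[ℂ] H) (V : ℕ → Submodule ℂ H) (lam : ℕ → ℂ) : Prop :=
  ∀ x y, (x, y) ∈ T.graph ↔ ∀ m, ∀ v ∈ V m, inner ℂ v y = lam m * inner ℂ v x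

namespace IsDiagonal

variable {V : ℕ → Submodule ℂ H} {T : H →ₗ.[ℂ] H} {lam : ℕ → ℂ}

theorem mem_graph_of_mem (hT : IsDiagonal T V lam) (hV : IsOrthogonalDecomposition V) {m : ℕ}
    {x : H} (hx : x ∈ V m) : (x, lam m • x) ∈ T.graph := by
  rw [hT]
  intro k v hv
  rw [inner_smul_right]
  by_cases h : k = m
  · rw [h]
  · rw [hV.orthogonal k m h v hv x hx, mul_zero, mul_zero]

/-- A vector whose components outside `V m` vanish lies in `V m`. -/
theorem _root_.FockComplex.IsOrthogonalDecomposition.mem_of_inner_eq_zero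
    [∀ m, FiniteDimensional ℂ (V m)] (hV : IsOrthogonalDecomposition V) {m : ℕ} {x : H}
    (hx : ∀ k, k ≠ m → ∀ v ∈ V k, inner ℂ v x = 0) : x ∈ V m := by
  rw [← Submodule.starProjection_eq_self_iff]
  refine hV.ext fun k v hv => ?_
  rw [hV.inner_starProjection hv]
  split_ifs with h
  · rfl
  · exact (hx k (fun h' => h h'.symm) v hv).symm

theorem eigenspaceOp_eq [∀ m, FiniteDimensional ℂ (V m)] (hT : IsDiagonal T V lam)
    (hV : IsOrthogonalDecomposition V) (hlam : Function.Injective lam) (m : ℕ) :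
    eigenspaceOp T (lam m) = V m := by
  ext x
  have h1 : x ∈ eigenspaceOp T (lam m) ↔ (x, lam m • x) ∈ T.graph := by
    rw [mem_eigenspaceOp, LinearPMap.mem_graph_iff]
    constructor
    · rintro ⟨h, h'⟩
      exact ⟨⟨x, h⟩, rfl, h'⟩
    · rintro ⟨y, rfl, h'⟩
      exact ⟨y.2, h'⟩
  rw [h1]
  refine ⟨fun h => hV.mem_of_inner_eq_zero fun k hk v hv => ?_, hT.mem_graph_of_mem hV⟩
  have h2 := (hT _ _).1 h k v hv
  rw [inner_smul_right] at h2
  exact (mul_eq_mul_right_iff.1 h2).resolve_left fun h3 => hk (hlam h3.symm)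

variable [∀ m, FiniteDimensional ℂ (V m)] [CompleteSpace H]

/-- Away from the diagonal entries there is a compact resolvent. -/
theorem exists_isBoundedInverse (hT : IsDiagonal T V lam) (hV : IsOrthogonalDecomposition V)
    (hlim : Tendsto lam atTop (Bornology.cobounded ℂ)) {c : ℂ} (hc : ∀ m, lam m ≠ c) :
    ∃ R : H →L[ℂ] H, IsBoundedInverse (subScalar T c) R ∧ IsCompactOperator R ∧
      ∀ m, ∀ v ∈ V m, ∀ x, inner ℂ v (R x) = (lam m - c)⁻¹ * inner ℂ v x := by
  have hlim' : Tendsto (fun m => (lam m - c)⁻¹) atTop (𝓝 0) := by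
    refine tendsto_inv₀_cobounded.comp ?_
    rw [← tendsto_norm_atTop_iff_cobounded] at hlim ⊢
    refine tendsto_atTop_mono (fun m => norm_sub_norm_le (lam m) c) ?_
    exact tendsto_atTop_add_const_right _ _ hlim
  obtain ⟨R, hR, hRv⟩ := hV.exists_isCompactOperator hlim'
  -- On the component `m` this is `1 + c/(λ_m - c) = λ_m/(λ_m - c)`; membership in the domain comes
  -- for free because the domain is maximal.
  have hgraph : ∀ u, (R u, u + c • R u) ∈ T.graph := fun u => by
    rw [hT]
    intro m v hv
    have := sub_ne_zero.2 (hc m)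
    rw [inner_add_right, inner_smul_right, hRv m v hv]
    field_simp
    ring
  have hdom : ∀ u, R u ∈ T.domain := fun u => LinearPMap.mem_domain_of_mem_graph (hgraph u)
  refine ⟨R, ⟨hdom, fun u => ?_, fun x => ?_⟩, hR, hRv⟩
  · have h1 : T ⟨R u, hdom u⟩ = u + c • R u :=
      (LinearPMap.image_iff (hdom u)).2 (hgraph u) |>.symm
    change T ⟨R u, hdom u⟩ - c • R u = u
    rw [h1, add_sub_cancel_right]
  · refine hV.ext fun m v hv => ?_
    have h1 := (hT _ _).1 (T.mem_graph ⟨x.1, x.2⟩) m v hv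
    change inner ℂ v (R (T ⟨x.1, x.2⟩ - c • x.1)) = _
    rw [hRv m v hv, inner_sub_right, inner_smul_right, h1, ← sub_mul,
      inv_mul_cancel_left₀ (sub_ne_zero.2 (hc m))]

/-- Every entry is an eigenvalue, and any other `c` has a bounded resolvent. No closure appears
because the entries tend to infinity. -/
theorem spectrumOp_eq (hT : IsDiagonal T V lam) (hV : IsOrthogonalDecomposition V)
    (hlim : Tendsto lam atTop (Bornology.cobounded ℂ)) (hne : ∀ m, V m ≠ ⊥) :
    spectrumOp T = Set.range lam := by
  ext c
  rw [← not_iff_not, show c ∈ spectrumOp T ↔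
    ¬ ∃ R : H →L[ℂ] H, IsBoundedInverse (subScalar T c) R from Iff.rfl, not_not, Set.mem_range,
    not_exists]
  constructor
  · rintro ⟨R, hR⟩ m rfl
    obtain ⟨x, hx, hx0⟩ := Submodule.exists_mem_ne_zero_of_ne_bot (hne m)
    have hg := hT.mem_graph_of_mem hV hx
    have hd : x ∈ T.domain := LinearPMap.mem_domain_of_mem_graph hg
    have h1 : T ⟨x, hd⟩ = lam m • x := (LinearPMap.image_iff hd).2 hg |>.symm
    have h2 : R (T ⟨x, hd⟩ - lam m • x) = x := hR.left_inv ⟨x, hd⟩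
    rw [h1, sub_self, map_zero] at h2
    exact hx0 h2.symm
  · intro hc
    obtain ⟨R, hR, -⟩ := hT.exists_isBoundedInverse hV hlim hc
    exact ⟨R, hR⟩

theorem exists_isBoundedInverse_self (hT : IsDiagonal T V lam) (hV : IsOrthogonalDecomposition V)
    (hlim : Tendsto lam atTop (Bornology.cobounded ℂ)) (hc : ∀ m, lam m ≠ 0) :
    ∃ R : H →L[ℂ] H, IsBoundedInverse T R ∧ IsCompactOperator R ∧
      ∀ m, ∀ v ∈ V m, ∀ x, inner ℂ v (R x) = (lam m)⁻¹ * inner ℂ v x := by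
  obtain ⟨R, hR, hRc, hRv⟩ := hT.exists_isBoundedInverse hV hlim hc
  have h0 : ∀ x : T.domain, subScalar T 0 x = T x := fun x => by
    change T x - (0 : ℂ) • x.1 = T x
    rw [zero_smul, sub_zero]
  exact ⟨R, ⟨hR.mem_domain, fun u => (h0 _).symm.trans (hR.right_inv u),
    fun x => (congrArg R (h0 x)).symm.trans (hR.left_inv x)⟩, hRc, by simpa using hRv⟩

end IsDiagonal

/-- The eigenspaces of a bounded diagonal operator. -/
theorem IsOrthogonalDecomposition.eigenspace_eq {V : ℕ → Submodule ℂ H}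
    [∀ m, FiniteDimensional ℂ (V m)] (hV : IsOrthogonalDecomposition V) {R : H →L[ℂ] H}
    {c : ℕ → ℂ} (hR : ∀ m, ∀ v ∈ V m, ∀ x, inner ℂ v (R x) = c m * inner ℂ v x)
    (hc : Function.Injective c) (m : ℕ) :
    Module.End.eigenspace (R : H →ₗ[ℂ] H) (c m) = V m := by
  ext x
  rw [Module.End.mem_eigenspace_iff]
  refine ⟨fun h => hV.mem_of_inner_eq_zero fun k hk v hv => ?_, fun hx => hV.ext fun k v hv => ?_⟩
  · have h1 := hR k v hv x
    rw [← ContinuousLinearMap.coe_coe, h, inner_smul_right] at h1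
    exact (mul_eq_mul_right_iff.1 h1).resolve_left fun h3 => hk (hc h3.symm)
  · rw [ContinuousLinearMap.coe_coe, hR k v hv, inner_smul_right]
    by_cases h : k = m
    · rw [h]
    · rw [hV.orthogonal k m h v hv x hx, mul_zero, mul_zero]

theorem IsOrthogonalDecomposition.hasEigenvalue_iff {V : ℕ → Submodule ℂ H}
    [∀ m, FiniteDimensional ℂ (V m)] (hV : IsOrthogonalDecomposition V) {R : H →L[ℂ] H}
    {c : ℕ → ℂ} (hR : ∀ m, ∀ v ∈ V m, ∀ x, inner ℂ v (R x) = c m * inner ℂ v x)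
    (hc : Function.Injective c) (hne : ∀ m, V m ≠ ⊥) (μ : ℂ) :
    Module.End.HasEigenvalue (R : H →ₗ[ℂ] H) μ ↔ ∃ m, μ = c m := by
  constructor
  · intro h
    obtain ⟨x, hx⟩ := h.exists_hasEigenvector
    by_contra! hm
    refine hx.2 (hV.total x fun m v hv => ?_)
    have h1 := hR m v hv x
    rw [← ContinuousLinearMap.coe_coe, hx.apply_eq_smul, inner_smul_right] at h1
    exact (mul_eq_mul_right_iff.1 h1).resolve_left (hm m)
  · rintro ⟨m, rfl⟩
    rw [Module.End.hasEigenvalue_iff, hV.eigenspace_eq hR hc]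
    exact hne m

end Diagonal

variable {n p : ℕ}

/-! ### Polynomial forms in the Hilbert space -/

/-- Polynomial forms as forms with coefficients in the Fock space. -/
def toForm (n p : ℕ) : PolyForms n p →ₗ[ℂ] Forms n p where
  toFun q := WithLp.toLp 2 fun J => toFock n (q J)
  map_add' q r := by
    ext J z
    simp
  map_smul' c q := by
    ext J z
    simp

@[simp] theorem toForm_apply (q : PolyForms n p) (J : MultiIndex n p) :
    toForm n p q J = toFock n (q J) := rfl

theorem toForm_injective : Function.Injective (toForm n p) := fun _ _ h =>
  funext fun J => toFock_injective (congrArg (fun f : Forms n p => f J) h)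

theorem inner_toForm (q : PolyForms n p) (f : Forms n p) :
    inner ℂ (toForm n p q) f = ∑ J, inner ℂ (toFock n (q J)) (f J) :=
  PiLp.inner_apply _ _

theorem inner_toForm_single (J : MultiIndex n p) (q : MvPolynomial (Fin n) ℂ) (f : Forms n p) :
    inner ℂ (toForm n p (Pi.single J q)) f = inner ℂ (toFock n q) (f J) := by
  rw [inner_toForm, Finset.sum_eq_single J]
  · simp
  · intro J' _ h
    simp [h]
  · simp

theorem eq_zero_of_inner_toForm {f : Forms n p} (hf : ∀ q, inner ℂ (toForm n p q) f = 0) :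
    f = 0 := by
  ext1 J
  refine Fock.eq_zero_of_inner_toFock fun q => ?_
  rw [← inner_toForm_single, hf]

theorem inner_toForm_polyDelStar (q : PolyForms n (p + 1)) (f : Forms n p) :
    inner ℂ (toForm n p (polyDelStar n p q)) f =
      ∑ K : MultiIndex n (p + 1), ∑ J : MultiIndex n p, ∑ j : Fin n,
        wedgeCoeff j J.1 K.1 * inner ℂ (toFock n (MvPolynomial.X j * q K)) (f J) := by
  rw [inner_toForm, Finset.sum_comm]
  simp only [polyDelStar_apply, map_sum, map_smul, sum_inner, inner_smul_left, conj_wedgeCoeff]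

/-- The maximal `∂` is the adjoint of its formal adjoint on polynomial forms: the weak equation,
tested on polynomials only, already gives the pointwise one. -/
theorem mem_delGraph_iff_inner (f : Forms n p) (g : Forms n (p + 1)) :
    (f, g) ∈ delGraph n p ↔ ∀ q : PolyForms n (p + 1),
      inner ℂ (toForm n (p + 1) q) g = inner ℂ (toForm n p (polyDelStar n p q)) f := by
  rw [mem_delGraph_iff]
  constructor
  · intro h q
    rw [inner_toForm_polyDelStar, inner_toForm]
    exact Finset.sum_congr rfl fun K _ => h K (q K)
  · intro h K q
    rw [← inner_toForm_single, h, inner_toForm_polyDelStar, Finset.sum_eq_single K]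
    · simp
    · intro K' _ hK
      simp [hK]
    · simp

theorem Fock.sum_apply {ι : Type*} (s : Finset ι) (f : ι → Fock n) (z : Fin n → ℂ) :
    (∑ i ∈ s, f i) z = ∑ i ∈ s, f i z := by
  classical
  induction s using Finset.induction_on with
  | empty => simp
  | insert a s ha ih => rw [Finset.sum_insert ha, Finset.sum_insert ha, Fock.add_apply, ih]

theorem toForm_mem_delGraph (q : PolyForms n p) :
    (toForm n p q, toForm n (p + 1) (polyDel n p q)) ∈ delGraph n p := by
  intro K z
  simp only [toForm_apply, delCoeff, partialZ_toFock, polyDel_apply, map_sum, map_smul,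
    Fock.sum_apply, Fock.smul_apply]
  exact Finset.sum_congr rfl fun J _ => Finset.sum_congr rfl fun j _ => mul_comm _ _

theorem inner_toForm_polyDel (q : PolyForms n p) (r : PolyForms n (p + 1)) :
    inner ℂ (toForm n (p + 1) r) (toForm n (p + 1) (polyDel n p q)) =
      inner ℂ (toForm n p (polyDelStar n p r)) (toForm n p q) :=
  (mem_delGraph_iff_inner _ _).1 (toForm_mem_delGraph q) r

theorem inner_polyDel_toForm (q : PolyForms n p) (r : PolyForms n (p + 1)) :
    inner ℂ (toForm n (p + 1) (polyDel n p q)) (toForm n (p + 1) r) =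
      inner ℂ (toForm n p q) (toForm n p (polyDelStar n p r)) := by
  rw [← inner_conj_symm, inner_toForm_polyDel, inner_conj_symm]

/-! ### The adjoint of `∂` -/

/-- The adjoint relation is single valued because the domain of `∂` contains the polynomial forms,
which are total. -/
theorem delStar_graph : (delStar n p).graph = (del n p).graph.adjoint := by
  refine Submodule.toLinearPMap_graph_eq _ fun x hx h0 => ?_
  rw [Submodule.mem_adjoint_iff] at hx
  refine eq_zero_of_inner_toForm fun q => ?_
  have h := hx _ _ (by rw [del_graph]; exact toForm_mem_delGraph q)
  rwa [h0, inner_zero_right, zero_sub, neg_eq_zero] at h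

theorem mem_delStar_graph_iff (g : Forms n (p + 1)) (h : Forms n p) :
    (g, h) ∈ (delStar n p).graph ↔
      ∀ a b, (a, b) ∈ delGraph n p → inner ℂ b g = inner ℂ a h := by
  rw [delStar_graph, Submodule.mem_adjoint_iff, del_graph]
  simp only [sub_eq_zero]

theorem inner_toForm_of_mem_delStar_graph {g : Forms n (p + 1)} {h : Forms n p}
    (hg : (g, h) ∈ (delStar n p).graph) (q : PolyForms n p) :
    inner ℂ (toForm n p q) h = inner ℂ (toForm n (p + 1) (polyDel n p q)) g :=
  ((mem_delStar_graph_iff g h).1 hg _ _ (toForm_mem_delGraph q)).symm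

theorem toForm_mem_delStar_graph (q : PolyForms n (p + 1)) :
    (toForm n (p + 1) q, toForm n p (polyDelStar n p q)) ∈ (delStar n p).graph := by
  rw [mem_delStar_graph_iff]
  intro a b hab
  have h := (mem_delGraph_iff_inner a b).1 hab q
  rw [← inner_conj_symm, h, inner_conj_symm]

/-! ### Closedness of `∂` and `∂*` along polynomial forms -/

section Limits

open Filter Topology

theorem mem_delGraph_of_tendsto {q : ℕ → PolyForms n p} {f : Forms n p} {g : Forms n (p + 1)}
    (hf : Tendsto (fun k => toForm n p (q k)) atTop (𝓝 f))
    (hg : Tendsto (fun k => toForm n (p + 1) (polyDel n p (q k))) atTop (𝓝 g)) :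
    (f, g) ∈ delGraph n p := by
  rw [mem_delGraph_iff_inner]
  intro r
  refine tendsto_nhds_unique (tendsto_const_nhds.inner hg) ?_
  simp only [inner_toForm_polyDel]
  exact tendsto_const_nhds.inner hf

theorem mem_delStar_graph_of_tendsto {q : ℕ → PolyForms n (p + 1)} {g : Forms n (p + 1)}
    {h : Forms n p} (hg : Tendsto (fun k => toForm n (p + 1) (q k)) atTop (𝓝 g))
    (hh : Tendsto (fun k => toForm n p (polyDelStar n p (q k))) atTop (𝓝 h)) :
    (g, h) ∈ (delStar n p).graph := by
  rw [mem_delStar_graph_iff]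
  intro a b hab
  refine tendsto_nhds_unique (tendsto_const_nhds.inner hg) ?_
  simp only [fun k => (mem_delStar_graph_iff _ _).1 (toForm_mem_delStar_graph (q k)) a b hab]
  exact tendsto_const_nhds.inner hh

end Limits

/-! ### The Laplacian on polynomial forms -/

/-- The complex Laplacian on polynomial forms. -/
def polyBox (n : ℕ) : (p : ℕ) → PolyForms n p →ₗ[ℂ] PolyForms n p
  | 0 => polyDelStar n 0 ∘ₗ polyDel n 0
  | p + 1 => polyDelStar n (p + 1) ∘ₗ polyDel n (p + 1) + polyDel n p ∘ₗ polyDelStar n p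

theorem polyBox_zero_apply (q : PolyForms n 0) :
    polyBox n 0 q = polyDelStar n 0 (polyDel n 0 q) := rfl

theorem polyBox_succ_apply (q : PolyForms n (p + 1)) : polyBox n (p + 1) q =
    polyDelStar n (p + 1) (polyDel n (p + 1) q) + polyDel n p (polyDelStar n p q) := rfl

theorem polyBox_of_isHomogeneous {m : ℕ} {q : PolyForms n p} (hq : ∀ J, (q J).IsHomogeneous m) :
    polyBox n p q = ((m + p : ℕ) : ℂ) • q := by
  ext1 J
  have hE : ∑ i, MvPolynomial.X i * MvPolynomial.pderiv i (q J) = (m : ℂ) • q J := by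
    rw [(hq J).sum_X_mul_pderiv, Nat.cast_smul_eq_nsmul]
  rw [Pi.smul_apply]
  cases p with
  | zero => rw [polyBox_zero_apply, polyLaplacian_zero, hE, add_zero]
  | succ p =>
    rw [polyBox_succ_apply, Pi.add_apply, polyLaplacian_succ, hE, ← add_smul]
    push_cast
    rfl

theorem inner_polyBox (q r : PolyForms n p) :
    inner ℂ (toForm n p (polyBox n p q)) (toForm n p r) =
      inner ℂ (toForm n p q) (toForm n p (polyBox n p r)) := by
  cases p with
  | zero =>
    rw [polyBox_zero_apply, polyBox_zero_apply, ← inner_toForm_polyDel, inner_polyDel_toForm]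
  | succ p =>
    rw [polyBox_succ_apply, polyBox_succ_apply, map_add, map_add, inner_add_left, inner_add_right,
      ← inner_toForm_polyDel, inner_polyDel_toForm, inner_polyDel_toForm, ← inner_toForm_polyDel]

/-- Since `∂² = 0`, the terms `∂*∂q` and `∂∂*q` are orthogonal, and Pythagoras bounds each by their
sum. -/
theorem norm_polyDelStar_polyDel_le (q : PolyForms n p) :
    ‖toForm n p (polyDelStar n p (polyDel n p q))‖ ≤ ‖toForm n p (polyBox n p q)‖ := by
  cases p with
  | zero => exact le_rfl
  | succ p =>
    have h : inner ℂ (toForm n (p + 1) (polyDelStar n (p + 1) (polyDel n (p + 1) q)))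
        (toForm n (p + 1) (polyDel n p (polyDelStar n p q))) = 0 := by
      rw [← inner_toForm_polyDel, polyDel_polyDel, map_zero, inner_zero_right]
    rw [polyBox_succ_apply, map_add]
    refine le_of_sq_le_sq ?_ (norm_nonneg _)
    rw [sq, sq, norm_add_sq_eq_norm_sq_add_norm_sq_of_inner_eq_zero _ _ h]
    exact le_add_of_nonneg_right (mul_self_nonneg _)

theorem norm_polyDel_polyDelStar_le (q : PolyForms n (p + 1)) :
    ‖toForm n (p + 1) (polyDel n p (polyDelStar n p q))‖ ≤
      ‖toForm n (p + 1) (polyBox n (p + 1) q)‖ := by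
  have h : inner ℂ (toForm n (p + 1) (polyDelStar n (p + 1) (polyDel n (p + 1) q)))
      (toForm n (p + 1) (polyDel n p (polyDelStar n p q))) = 0 := by
    rw [← inner_toForm_polyDel, polyDel_polyDel, map_zero, inner_zero_right]
  rw [polyBox_succ_apply, map_add]
  refine le_of_sq_le_sq ?_ (norm_nonneg _)
  rw [sq, sq, norm_add_sq_eq_norm_sq_add_norm_sq_of_inner_eq_zero _ _ h]
  exact le_add_of_nonneg_left (mul_self_nonneg _)

theorem le_add_of_sq_le_mul {x a b c : ℝ} (ha : 0 ≤ a) (hb : 0 ≤ b) (hbc : b ≤ c)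
    (h : x ^ 2 ≤ a * b) : x ≤ a + c := by
  refine le_of_sq_le_sq ?_ (by linarith)
  nlinarith [mul_nonneg ha hb]

/-- From `‖∂q‖² = (q, ∂*∂q) ≤ ‖q‖ ‖∂*∂q‖` and the bound of `∂*∂q` by the Laplacian. -/
theorem norm_polyDel_le (q : PolyForms n p) :
    ‖toForm n (p + 1) (polyDel n p q)‖ ≤ ‖toForm n p q‖ + ‖toForm n p (polyBox n p q)‖ := by
  refine le_add_of_sq_le_mul (norm_nonneg _) (norm_nonneg _) (norm_polyDelStar_polyDel_le q) ?_
  rw [@norm_sq_eq_re_inner ℂ, inner_polyDel_toForm]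
  exact re_inner_le_norm _ _

theorem norm_polyDelStar_le (q : PolyForms n (p + 1)) :
    ‖toForm n p (polyDelStar n p q)‖ ≤
      ‖toForm n (p + 1) q‖ + ‖toForm n (p + 1) (polyBox n (p + 1) q)‖ := by
  refine le_add_of_sq_le_mul (norm_nonneg _) (norm_nonneg _) (norm_polyDel_polyDelStar_le q) ?_
  rw [@norm_sq_eq_re_inner ℂ, ← inner_toForm_polyDel]
  exact re_inner_le_norm _ _

/-! ### Homogeneous forms -/

/-- Forms whose coefficients are homogeneous polynomials of degree `m`. -/
def homForms (n p m : ℕ) : Submodule ℂ (Forms n p) :=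
  LinearMap.range (toForm n p ∘ₗ
    (MvPolynomial.homogeneousSubmodule (Fin n) ℂ m).subtype.compLeft (MultiIndex n p))

theorem mem_homForms {m : ℕ} {f : Forms n p} : f ∈ homForms n p m ↔
    ∃ q : PolyForms n p, (∀ J, (q J).IsHomogeneous m) ∧ toForm n p q = f := by
  constructor
  · rintro ⟨q, rfl⟩
    exact ⟨fun J => q J, fun J => (q J).2, rfl⟩
  · rintro ⟨q, hq, rfl⟩
    exact ⟨fun J => ⟨q J, hq J⟩, rfl⟩

instance (m : ℕ) : Module.Finite ℂ (MvPolynomial.homogeneousSubmodule (Fin n) ℂ m) :=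
  Module.Finite.iff_fg.2 (MvPolynomial.homogeneousSubmodule_fg (Fin n) ℂ m)

instance (m : ℕ) : FiniteDimensional ℂ (homForms n p m) :=
  LinearMap.finiteDimensional_range _

theorem finrank_homogeneousSubmodule (n m : ℕ) :
    Module.finrank ℂ (MvPolynomial.homogeneousSubmodule (Fin n) ℂ m) = (n + m - 1).choose m := by
  rw [MvPolynomial.homogeneousSubmodule_eq_finsupp_supported]
  rw [Module.finrank_eq_nat_card_basis (Module.Basis.ofRepr
    (AddMonoidAlgebra.supportedEquivFinsupp (R := ℂ) (S := ℂ) {d : Fin n →₀ ℕ | d.degree = m}))]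
  have h : {d : Fin n →₀ ℕ | d.degree = m} =
      ((Finset.univ.finsuppAntidiag m : Finset (Fin n →₀ ℕ)) : Set (Fin n →₀ ℕ)) := by
    ext d
    simp [Finsupp.degree_eq_sum]
  rw [h, Nat.card_coe_set_eq, Set.ncard_coe_finset, Finset.card_finsuppAntidiag_nat_eq_choose,
    Finset.card_univ, Fintype.card_fin]

theorem finrank_homForms (hn : 1 ≤ n) (m : ℕ) :
    Module.finrank ℂ (homForms n p m) = (n + m - 1).choose (n - 1) * n.choose p := by
  have hinj : Function.Injective (toForm n p ∘ₗ
      (MvPolynomial.homogeneousSubmodule (Fin n) ℂ m).subtype.compLeft (MultiIndex n p)) := by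
    intro q r h
    have h1 := toForm_injective h
    exact funext fun J => Subtype.ext (congrFun h1 J)
  rw [homForms, LinearMap.finrank_range_of_inj hinj, Module.finrank_pi_fintype]
  simp only [finrank_homogeneousSubmodule, Finset.sum_const, Finset.card_univ,
    Fintype.card_finset_len, Fintype.card_fin, smul_eq_mul]
  -- The hypothesis `1 ≤ n` keeps the truncated subtraction `n - 1` exact.
  rw [mul_comm, Nat.choose_symm_of_eq_add (by omega : n + m - 1 = (n - 1) + m)]

theorem homForms_ne_bot (hn : 1 ≤ n) (hp : p ≤ n) (m : ℕ) : homForms n p m ≠ ⊥ := by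
  intro h
  have h1 := finrank_homForms (p := p) hn m
  rw [h, finrank_bot] at h1
  exact (Nat.mul_pos (Nat.choose_pos (by omega)) (Nat.choose_pos hp)).ne h1

theorem isOrthogonalDecomposition_homForms (n p : ℕ) :
    IsOrthogonalDecomposition (homForms n p) := by
  refine ⟨fun m k hmk v hv w hw => ?_, fun f hf => ?_⟩
  · obtain ⟨q, hq, rfl⟩ := mem_homForms.1 hv
    obtain ⟨r, hr, rfl⟩ := mem_homForms.1 hw
    -- Eigenvectors of a symmetric operator with distinct eigenvalues `m + p` and `k + p` are
    -- orthogonal; no Gaussian integrals of monomials are needed.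
    have h := inner_polyBox q r
    rw [polyBox_of_isHomogeneous hq, polyBox_of_isHomogeneous hr, map_smul, map_smul,
      inner_smul_left, inner_smul_right, Complex.conj_natCast] at h
    refine (mul_eq_mul_right_iff.1 h).resolve_left fun h' => hmk ?_
    have h2 : m + p = k + p := by exact_mod_cast h'
    omega
  · ext1 J
    refine Fock.eq_zero_of_inner_toFock fun q => ?_
    rw [← MvPolynomial.sum_homogeneousComponent q, map_sum, sum_inner]
    refine Finset.sum_eq_zero fun m _ => ?_
    rw [← inner_toForm_single]
    refine hf m _ (mem_homForms.2 ⟨_, fun J' => ?_, rfl⟩)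
    by_cases h : J' = J
    · subst h
      rw [Pi.single_eq_same]
      exact MvPolynomial.homogeneousComponent_isHomogeneous m q
    · rw [Pi.single_eq_of_ne h]
      exact MvPolynomial.isHomogeneous_zero _ _ _

/-! ### The Laplacian is diagonal -/

section Graphs

variable {E F G : Type*} [NormedAddCommGroup E] [NormedSpace ℂ E] [NormedAddCommGroup F]
  [NormedSpace ℂ F] [NormedAddCommGroup G] [NormedSpace ℂ G]

theorem mem_compOp_graph (S : F →ₗ.[ℂ] G) (T : E →ₗ.[ℂ] F) (x : E) (z : G) :
    (x, z) ∈ (compOp S T).graph ↔ ∃ y, (x, y) ∈ T.graph ∧ (y, z) ∈ S.graph := by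
  simp only [LinearPMap.mem_graph_iff]
  constructor
  · rintro ⟨⟨x, hx⟩, rfl, rfl⟩
    obtain ⟨h, h'⟩ := (mem_compOp_domain S T x).1 hx
    exact ⟨T ⟨x, h⟩, ⟨⟨x, h⟩, rfl, rfl⟩, ⟨⟨_, h'⟩, rfl, rfl⟩⟩
  · rintro ⟨y, ⟨⟨x, h⟩, rfl, rfl⟩, ⟨⟨y, h'⟩, rfl, rfl⟩⟩
    exact ⟨⟨x, (mem_compOp_domain S T x).2 ⟨h, h'⟩⟩, rfl, rfl⟩

theorem mem_add_graph (S T : E →ₗ.[ℂ] F) (x : E) (z : F) :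
    (x, z) ∈ (S + T).graph ↔ ∃ a b, (x, a) ∈ S.graph ∧ (x, b) ∈ T.graph ∧ a + b = z := by
  simp only [LinearPMap.mem_graph_iff]
  constructor
  · rintro ⟨⟨x, hx⟩, rfl, rfl⟩
    exact ⟨_, _, ⟨⟨x, hx.1⟩, rfl, rfl⟩, ⟨⟨x, hx.2⟩, rfl, rfl⟩, rfl⟩
  · rintro ⟨a, b, ⟨⟨x, h⟩, rfl, rfl⟩, ⟨⟨y, h'⟩, rfl, rfl⟩, rfl⟩
    exact ⟨⟨_, ⟨h, h'⟩⟩, rfl, rfl⟩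

end Graphs

open Filter Topology

theorem mem_box_zero_graph (f h : Forms n 0) : (f, h) ∈ (box n 0).graph ↔
    ∃ g, (f, g) ∈ delGraph n 0 ∧ (g, h) ∈ (delStar n 0).graph := by
  rw [← del_graph]
  exact mem_compOp_graph _ _ _ _

theorem mem_box_succ_graph (f h : Forms n (p + 1)) : (f, h) ∈ (box n (p + 1)).graph ↔
    ∃ a b, (∃ g, (f, g) ∈ delGraph n (p + 1) ∧ (g, a) ∈ (delStar n (p + 1)).graph) ∧
      (∃ g, (f, g) ∈ (delStar n p).graph ∧ (g, b) ∈ delGraph n p) ∧ a + b = h := by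
  rw [← del_graph, ← del_graph]
  simp only [← mem_compOp_graph]
  exact mem_add_graph _ _ _ _

/-- All operators move onto the polynomial form `q`, which lies in every domain that occurs. -/
theorem inner_toForm_of_mem_box_graph {f h : Forms n p} (hf : (f, h) ∈ (box n p).graph)
    (q : PolyForms n p) :
    inner ℂ (toForm n p q) h = inner ℂ (toForm n p (polyBox n p q)) f := by
  cases p with
  | zero =>
    obtain ⟨g, h1, h2⟩ := (mem_box_zero_graph f h).1 hf
    rw [inner_toForm_of_mem_delStar_graph h2, (mem_delGraph_iff_inner _ _).1 h1,
      polyBox_zero_apply]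
  | succ p =>
    obtain ⟨a, b, ⟨g, h1, h2⟩, ⟨g', h3, h4⟩, rfl⟩ := (mem_box_succ_graph f h).1 hf
    rw [inner_add_right, inner_toForm_of_mem_delStar_graph h2, (mem_delGraph_iff_inner _ _).1 h1,
      (mem_delGraph_iff_inner _ _).1 h4, inner_toForm_of_mem_delStar_graph h3, polyBox_succ_apply,
      map_add, inner_add_left]

theorem exists_tendsto_of_norm_le {E : Type*} [NormedAddCommGroup E] [NormedSpace ℂ E]
    [CompleteSpace E] (A : PolyForms n p →ₗ[ℂ] E)
    (hA : ∀ q, ‖A q‖ ≤ ‖toForm n p q‖ + ‖toForm n p (polyBox n p q)‖) {q : ℕ → PolyForms n p}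
    {f h : Forms n p} (hf : Tendsto (fun k => toForm n p (q k)) atTop (𝓝 f))
    (hh : Tendsto (fun k => toForm n p (polyBox n p (q k))) atTop (𝓝 h)) :
    ∃ a, Tendsto (fun k => A (q k)) atTop (𝓝 a) := by
  refine cauchySeq_tendsto_of_complete (Metric.cauchySeq_iff.2 fun ε hε => ?_)
  obtain ⟨N, hN⟩ := Metric.cauchySeq_iff.1 hf.cauchySeq (ε / 2) (by positivity)
  obtain ⟨M, hM⟩ := Metric.cauchySeq_iff.1 hh.cauchySeq (ε / 2) (by positivity)
  refine ⟨max N M, fun m hm k hk => ?_⟩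
  have h1 := hN m (le_of_max_le_left hm) k (le_of_max_le_left hk)
  have h2 := hM m (le_of_max_le_right hm) k (le_of_max_le_right hk)
  have h3 := hA (q m - q k)
  rw [dist_eq_norm] at h1 h2 ⊢
  rw [map_sub, map_sub, map_sub, map_sub] at h3
  linarith

/-- Convergence of `q_k` and `□q_k` forces convergence of each intermediate form by the norm
estimates, and closedness of `∂` and `∂*` then places the limits in the required domains. -/
theorem mem_box_graph_of_tendsto {q : ℕ → PolyForms n p} {f h : Forms n p}
    (hf : Tendsto (fun k => toForm n p (q k)) atTop (𝓝 f))
    (hh : Tendsto (fun k => toForm n p (polyBox n p (q k))) atTop (𝓝 h)) :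
    (f, h) ∈ (box n p).graph := by
  obtain ⟨g, hg⟩ := exists_tendsto_of_norm_le (toForm n (p + 1) ∘ₗ polyDel n p)
    norm_polyDel_le hf hh
  cases p with
  | zero =>
    exact (mem_box_zero_graph f h).2
      ⟨g, mem_delGraph_of_tendsto hf hg, mem_delStar_graph_of_tendsto hg hh⟩
  | succ p =>
    obtain ⟨a, ha⟩ := exists_tendsto_of_norm_le
      (toForm n (p + 1) ∘ₗ polyDelStar n (p + 1) ∘ₗ polyDel n (p + 1))
      (fun q => (norm_polyDelStar_polyDel_le q).trans (le_add_of_nonneg_left (norm_nonneg _))) hf hh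
    obtain ⟨g', hg'⟩ := exists_tendsto_of_norm_le (toForm n p ∘ₗ polyDelStar n p)
      norm_polyDelStar_le hf hh
    obtain ⟨b, hb⟩ := exists_tendsto_of_norm_le
      (toForm n (p + 1) ∘ₗ polyDel n p ∘ₗ polyDelStar n p)
      (fun q => (norm_polyDel_polyDelStar_le q).trans (le_add_of_nonneg_left (norm_nonneg _))) hf hh
    refine (mem_box_succ_graph f h).2 ⟨a, b, ⟨g, mem_delGraph_of_tendsto hf hg,
      mem_delStar_graph_of_tendsto hg ha⟩, ⟨g', mem_delStar_graph_of_tendsto hf hg',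
      mem_delGraph_of_tendsto hg' hb⟩, tendsto_nhds_unique (ha.add hb) ?_⟩
    simpa only [polyBox_succ_apply, map_add] using! hh

theorem isDiagonal_box (n p : ℕ) :
    IsDiagonal (box n p) (homForms n p) fun m => ((m + p : ℕ) : ℂ) := by
  have hV := isOrthogonalDecomposition_homForms n p
  intro f h
  constructor
  · intro hf m v hv
    obtain ⟨q, hq, rfl⟩ := mem_homForms.1 hv
    rw [inner_toForm_of_mem_box_graph hf, polyBox_of_isHomogeneous hq, map_smul, inner_smul_left,
      Complex.conj_natCast]
  · intro hfh
    have hr : ∀ m, ∃ q : PolyForms n p, (∀ J, (q J).IsHomogeneous m) ∧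
        toForm n p q = (homForms n p m).starProjection f :=
      fun m => mem_homForms.1 (Submodule.starProjection_apply_mem _ _)
    choose r hr hrf using hr
    have hrh : ∀ m, toForm n p (polyBox n p (r m)) = (homForms n p m).starProjection h := by
      intro m
      rw [polyBox_of_isHomogeneous (hr m), map_smul, hrf]
      refine hV.ext fun k v hv => ?_
      rw [inner_smul_right, hV.inner_starProjection hv, hV.inner_starProjection hv]
      split_ifs with hmk
      · rw [hfh k v hv, hmk]
      · rw [mul_zero]
    -- The partial sums of the homogeneous expansion of `f` are polynomial, and their Laplacians are
    -- the partial sums of the expansion of `h`.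
    refine mem_box_graph_of_tendsto (q := fun M => ∑ m ∈ Finset.range M, r m) ?_ ?_
    · simp only [map_sum, hrf]
      exact (hV.hasSum_starProjection f).tendsto_sum_nat
    · simp only [map_sum, hrh]
      exact (hV.hasSum_starProjection h).tendsto_sum_nat

theorem tendsto_natCast_add_cobounded (p : ℕ) :
    Tendsto (fun m : ℕ => ((m + p : ℕ) : ℂ)) atTop (Bornology.cobounded ℂ) := by
  rw [← tendsto_norm_atTop_iff_cobounded]
  simp only [Complex.norm_natCast]
  exact tendsto_natCast_atTop_atTop.comp (tendsto_add_atTop_nat p)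

end FockComplex

/-! ### Spectrum, multiplicities and the compact inverse -/

theorem mainTheorem1 (n p : ℕ) (hn : 1 ≤ n) (hp : p ≤ n) :
    FockComplex.spectrumOp (FockComplex.box n p) = Set.range (fun m : ℕ => ((m + p : ℕ) : ℂ)) ∧
    (∀ m : ℕ,
      Module.finrank ℂ (FockComplex.eigenspaceOp (FockComplex.box n p) ((m + p : ℕ) : ℂ)) =
        (n + m - 1).choose (n - 1) * n.choose p) ∧
    (1 ≤ p →
      ∃ N : FockComplex.Forms n p →L[ℂ] FockComplex.Forms n p,
        FockComplex.IsBoundedInverse (FockComplex.box n p) N ∧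
        IsCompactOperator N ∧
        (∀ c : ℂ, Module.End.HasEigenvalue
            (N : FockComplex.Forms n p →ₗ[ℂ] FockComplex.Forms n p) c ↔
          ∃ m : ℕ, c = 1 / ((m + p : ℕ) : ℂ)) ∧
        ∀ m : ℕ, Module.finrank ℂ (Module.End.eigenspace
            (N : FockComplex.Forms n p →ₗ[ℂ] FockComplex.Forms n p) (1 / ((m + p : ℕ) : ℂ))) =
          (n + m - 1).choose (n - 1) * n.choose p) := by
  have hV := FockComplex.isOrthogonalDecomposition_homForms n p
  have hT := FockComplex.isDiagonal_box n p
  have hlim := FockComplex.tendsto_natCast_add_cobounded p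
  have hinj : Function.Injective fun m : ℕ => ((m + p : ℕ) : ℂ) := fun m k h => by
    have : m + p = k + p := Nat.cast_injective (R := ℂ) h
    omega
  have hne := FockComplex.homForms_ne_bot (n := n) (p := p) hn hp
  refine ⟨hT.spectrumOp_eq hV hlim hne, fun m => ?_, fun hp1 => ?_⟩
  · rw [hT.eigenspaceOp_eq hV hinj m, FockComplex.finrank_homForms hn]
  -- For `p ≥ 1` no entry `m + p` is zero, so the resolvent at `0` exists.
  · obtain ⟨N, hN, hNc, hNv⟩ := hT.exists_isBoundedInverse_self hV hlim fun m => by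
      exact_mod_cast (by omega : m + p ≠ 0)
    have hinj' : Function.Injective fun m : ℕ => ((m + p : ℕ) : ℂ)⁻¹ :=
      inv_injective.comp hinj
    refine ⟨N, hN, hNc, fun c => ?_, fun m => ?_⟩
    · simpa only [one_div] using hV.hasEigenvalue_iff hNv hinj' hne c
    · rw [one_div, hV.eigenspace_eq hNv hinj' m, FockComplex.finrank_homForms hn]

end
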